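/- Let $(L_t)_{t\ge 0}$ be a one-dimensional càdlàg Lévy process with respect to a filtration $(\mathfrak F_t)$ on a probability space $(\Omega,\mathfrak F,P)$, whose Lévy measure $F_L$ satisfies, for some $M>0$, $\int_{|x|>1}e^{vx}F_L(dx)<\infty$ for every $|v|\le M$, and assume $\operatorname{Var}(L_1)>0$. Let $\lambda_0>0$ and let $(Y_t)_{t\ge0}$ be the Ornstein–Uhlenbeck process $$Y_t=e^{-\lambda_0 t}Y_0+e^{-\lambda_0 t}\int_0^{\lambda_0 t}e^{s}\,dL_s ,$$ where $Y_0$ is independent of $(L_t)_{t\ge0}$ and has the same distribution as $\int_0^\infty e^{-s}\,dL_s$. For $n\ge 1$ put $\bar Y_n=\frac1n\sum_{i=1}^nY_i$, $\hat\gamma_n(h)=\frac1n\sum_{i=1}^{n-h}(Y_{i+h}-\bar Y_n)(Y_i-\bar Y_n)$ and $\hat\rho_n(h)=\hat\gamma_n(h)/\hat\gamma_n(0)$ (with the convention $\hat\rho_n(h)=0$ if $\hat\gamma_n(0)=0$). Let $d\ge1$ be fixed, let $K\subset[0,\infty)$ be a compact set with $\lambda_0\in K$, and let $$A_n=\operatorname*{argmin}_{\lambda\in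 K}\ \sum_{h=1}^d\bigl(\hat\rho_n(h)-e^{-\lambda h}\bigr)^2\subset K$$ be the (random) set of minimizers, i.e. of least-squares estimates $\hat\lambda_n$. Then: 1. (existence) $A_n\neq\emptyset$ for every $n$ and every $\omega\in\Omega$; 2. (local uniqueness) for every $n$ and every $\omega$, each point of $A_n$ has a neighbourhood that contains no other point of $A_n$; moreover, if $K\cap[\lambda_0-\varepsilon,\lambda_0+\varepsilon]$ is an interval for some $\varepsilon>0$, then almost surely $A_n$ consists of exactly one point for all sufficiently large $n$; 3. (strong consistency) almost surely, every sequence $(\hat\lambda_n)$ with $\hat\lambda_n\in A_n$ for all $n$ satisfies $\hat\lambda_n\to\lambda_0$ as $n\to\infty$. -/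

import Mathlib

open MeasureTheory ProbabilityTheory Filter Topology
open scoped NNReal ENNReal

namespace LevyOU

/-- A one-dimensional càdlàg Lévy process `L` with respect to the filtration `𝓕`. -/
structure IsLevyProcess {Ω : Type*} {mΩ : MeasurableSpace Ω} (P : Measure Ω)
    (𝓕 : Filtration ℝ≥0 mΩ) (L : ℝ≥0 → Ω → ℝ) : Prop where
  adapted : ∀ t, Measurable[𝓕 t] (L t)
  zero : ∀ᵐ ω ∂P, L 0 ω = 0
  indep_increment : ∀ s t, s ≤ t →
    Indep (MeasurableSpace.comap (fun ω => L t ω - L s ω) inferInstance) (𝓕 s) P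
  stationary_increment : ∀ s t, s ≤ t →
    IdentDistrib (fun ω => L t ω - L s ω) (L (t - s)) P P
  continuous_in_probability : ∀ t, TendstoInMeasure P L (𝓝 t) (L t)
  cadlag : ∀ᵐ ω ∂P, ∀ t : ℝ≥0,
    ContinuousWithinAt (fun s => L s ω) (Set.Ici t) t ∧
      ∃ l : ℝ, Tendsto (fun s => L s ω) (𝓝[<] t) (𝓝 l)

/-- `ν` is the Lévy measure of the infinitely divisible law `m` on `ℝ`: `ν` does not charge `0`,
it integrates `min(1, x²)`, and for some drift `b` and some Gaussian variance `c ≥ 0` the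
Lévy–Khintchine formula
`∫ e^{iux} m(dx) = exp(ibu - cu²/2 + ∫ (e^{iux} - 1 - iux 1_{|x| ≤ 1}) ν(dx))` holds. -/
def IsLevyMeasure (ν m : Measure ℝ) : Prop :=
  ν {0} = 0 ∧ (∫⁻ x, ENNReal.ofReal (min 1 (x ^ 2)) ∂ν) < ∞ ∧
    ∃ b c : ℝ, 0 ≤ c ∧ ∀ u : ℝ,
      charFun m u = Complex.exp (Complex.I * b * u - c * u ^ 2 / 2 +
        ∫ x : ℝ, (Complex.exp (Complex.I * u * x) - 1 -
          Complex.I * u * (Set.indicator {y : ℝ | |y| ≤ 1} (fun y => y) x : ℝ)) ∂ν)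

/-- The exponential moment condition: for some `M > 0`,
`∫_{|x| > 1} e^{vx} ν(dx) < ∞` for every `|v| ≤ M`. -/
def ExpMomentCondition (ν : Measure ℝ) : Prop :=
  ∃ M : ℝ, 0 < M ∧ ∀ v : ℝ, |v| ≤ M →
    (∫⁻ x in {x : ℝ | 1 < |x|}, ENNReal.ofReal (Real.exp (v * x)) ∂ν) < ∞

/-- The left-point sum `∑_{i < N} f(t_i) (L_{t_{i+1}} - L_{t_i})`. -/
noncomputable def leftSum {Ω : Type*} (f : ℝ≥0 → ℝ) (L : ℝ≥0 → Ω → ℝ) (N : ℕ) (t : ℕ → ℝ≥0)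
    (ω : Ω) : ℝ :=
  ∑ i ∈ Finset.range N, f (t i) * (L (t (i + 1)) ω - L (t i) ω)

/-- `I = ∫_a^b f(s) dL_s`, the stochastic integral of a continuous nonrandom function `f`: the
left-point sums over the partitions `a = t_0 ≤ t_1 ≤ … ≤ t_N = b` converge to `I` in probability
as the mesh of the partition tends to `0`. -/
def IsStochIntegral {Ω : Type*} {mΩ : MeasurableSpace Ω} (P : Measure Ω) (f : ℝ≥0 → ℝ)
    (L : ℝ≥0 → Ω → ℝ) (a b : ℝ≥0) (I : Ω → ℝ) : Prop :=
  ∀ ε : ℝ, 0 < ε → ∃ δ : ℝ≥0, 0 < δ ∧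
    ∀ (N : ℕ) (t : ℕ → ℝ≥0), Monotone t → t 0 = a → t N = b →
      (∀ i < N, t (i + 1) - t i ≤ δ) →
        P {ω | ε ≤ |leftSum f L N t ω - I ω|} ≤ ENNReal.ofReal ε

/-- `I = ∫_a^∞ f(s) dL_s`, the limit in probability of `∫_a^T f(s) dL_s` as `T → ∞`. -/
def IsImproperStochIntegral {Ω : Type*} {mΩ : MeasurableSpace Ω} (P : Measure Ω) (f : ℝ≥0 → ℝ)
    (L : ℝ≥0 → Ω → ℝ) (a : ℝ≥0) (I : Ω → ℝ) : Prop :=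
  ∃ J : ℝ≥0 → Ω → ℝ, (∀ T, a ≤ T → IsStochIntegral P f L a T (J T)) ∧
    TendstoInMeasure P J atTop I

/-- `Y` is the Ornstein–Uhlenbeck process with mean reverting parameter `lam` driven by `L`:
`Y_t = e^{-lam t} Y_0 + e^{-lam t} ∫_0^{lam t} e^s dL_s` almost surely, for each `t ≥ 0`. -/
def IsOUProcess {Ω : Type*} {mΩ : MeasurableSpace Ω} (P : Measure Ω) (L : ℝ≥0 → Ω → ℝ)
    (lam : ℝ≥0) (Y : ℝ≥0 → Ω → ℝ) : Prop :=
  ∀ t : ℝ≥0, ∃ I : Ω → ℝ,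
    IsStochIntegral P (fun s => Real.exp s) L 0 (lam * t) I ∧
      ∀ᵐ ω ∂P, Y t ω = Real.exp (-(lam * t)) * Y 0 ω + Real.exp (-(lam * t)) * I ω

/-- The sample mean `(1/n) ∑_{i=1}^n y_i`. -/
noncomputable def sampleMean (y : ℕ → ℝ) (n : ℕ) : ℝ :=
  (1 / (n : ℝ)) * ∑ i ∈ Finset.Icc 1 n, y i

/-- The sample autocovariance `γ̂_n(h) = (1/n) ∑_{i=1}^{n-h} (y_{i+h} - ȳ)(y_i - ȳ)`
(the sum is empty for `h ≥ n`). -/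
noncomputable def sampleAutocov (y : ℕ → ℝ) (n h : ℕ) : ℝ :=
  (1 / (n : ℝ)) *
    ∑ i ∈ Finset.Icc 1 (n - h), (y (i + h) - sampleMean y n) * (y i - sampleMean y n)

/-- The sample autocorrelation `ρ̂_n(h) = γ̂_n(h) / γ̂_n(0)` (equal to `0` if `γ̂_n(0) = 0`). -/
noncomputable def sampleAutocorr (y : ℕ → ℝ) (n h : ℕ) : ℝ :=
  sampleAutocov y n h / sampleAutocov y n 0

/-- The least-squares criterion `∑_{h=1}^d (ρ̂_n(h) - e^{-x h})²`. -/
noncomputable def lsCriterion (y : ℕ → ℝ) (d n : ℕ) (x : ℝ) : ℝ :=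
  ∑ h ∈ Finset.Icc 1 d, (sampleAutocorr y n h - Real.exp (-(x * h))) ^ 2

/-- The set `argmin_{x ∈ K} ∑_{h=1}^d (ρ̂_n(h) - e^{-x h})²` of all least-squares estimates. -/
def lsArgmin (K : Set ℝ) (y : ℕ → ℝ) (d n : ℕ) : Set ℝ :=
  {x | x ∈ K ∧ IsMinOn (lsCriterion y d n) K x}

/-- The discrete-time observations `i ↦ Y_i(ω)`. -/
def observations {Ω : Type*} (Y : ℝ≥0 → Ω → ℝ) (ω : Ω) (i : ℕ) : ℝ := Y (i : ℝ≥0) ω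

end LevyOU

/-!
The observations satisfy the autoregression `Y_{j+1} = e^{-λ₀} Y_j + ξ_j`, where `ξ_j` is the limit
in probability of left-point sums of `e^{s - λ₀ (j+1)}` over `[λ₀ j, λ₀ (j+1)]`. The characteristic
functions of these sums do not depend on `j` and are unaffected by conditioning on the past, so the
`ξ_j` are identically distributed and independent of the past (`IsLevyProcess.indep_innovation`,
`IsLevyProcess.identDistrib_innovation`). They are square integrable and nondegenerate
(`IsLevyProcess.memLp_innovation_and_variance_pos`), because `L_1` is: its second moment is finite
by the Lévy–Khintchine formula and the exponential moments of the Lévy measure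
(`memLp_two_of_isLevyMeasure`).

For such an autoregression the lag-`h` sample autocorrelation converges almost surely to
`e^{-λ₀ h}`, whatever the initial value (`IsInnovation.ae_tendsto_sampleAutocorr`). This replaces
the ergodic theorem for the stationary process: summing the recursions for `Y`, `Y²` and
`Y_{i+h} Y_i` leaves averages of `ξ²`, to which the strong law for independent variables applies,
and averages of `ξ_{i+h} Y_i` with centred `ξ`, whose terms are orthogonal and which vanish by the
strong law `ae_tendsto_average_of_orthogonal`.

The rest is deterministic. In the variable `z = e^{-x}` the criterion is a polynomial of positive
degree, so it has finitely many minimizers (`finite_lsArgmin`). Its value at `λ₀` tends to `0`,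
which forces all minimizers to `λ₀` (`eventually_lsArgmin_exp_close`). Near `e^{-λ₀}` it is eventually
strictly midpoint convex in `z`, which gives uniqueness when `K` is an interval near `λ₀`
(`eventually_existsUnique_lsArgmin`).
-/

namespace LevyOU

/-! ### The least-squares criterion -/

lemma continuous_lsCriterion (y : ℕ → ℝ) (d n : ℕ) : Continuous (lsCriterion y d n) := by
  unfold lsCriterion
  fun_prop

lemma lsArgmin_nonempty {K : Set ℝ} (hK : IsCompact K) (hne : K.Nonempty) (y : ℕ → ℝ) (d n : ℕ) :
    (lsArgmin K y d n).Nonempty := by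
  obtain ⟨x, hx, hmin⟩ := hK.exists_isMinOn hne (continuous_lsCriterion y d n).continuousOn
  exact ⟨x, hx, hmin⟩

/-- In the variable `z = e^{-x}` the criterion is a nonconstant polynomial, so it takes each value
finitely often. -/
lemma finite_setOf_lsCriterion_eq (y : ℕ → ℝ) {d : ℕ} (hd : 1 ≤ d) (n : ℕ) (c : ℝ) :
    {x | lsCriterion y d n x = c}.Finite := by
  let p : Polynomial ℝ := ∑ h ∈ Finset.Icc 1 d,
    (Polynomial.C (sampleAutocorr y n h) - Polynomial.X ^ h) ^ 2 - Polynomial.C c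
  have hp (z : ℝ) : p.eval z = ∑ h ∈ Finset.Icc 1 d, (sampleAutocorr y n h - z ^ h) ^ 2 - c := by
    simp [p, Polynomial.eval_finsetSum]
  have hp0 : p ≠ 0 := by
    intro h0
    have h1 := hp (sampleAutocorr y n 1 + |c| + 1)
    have h2 := Finset.single_le_sum
      (f := fun h => (sampleAutocorr y n h - (sampleAutocorr y n 1 + |c| + 1) ^ h) ^ 2)
      (fun h _ => sq_nonneg _) (Finset.mem_Icc.2 ⟨le_rfl, hd⟩)
    rw [h0, Polynomial.eval_zero] at h1
    simp only [pow_one] at h2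
    nlinarith [le_abs_self c, abs_nonneg c]
  have hinj : Function.Injective fun x : ℝ => Real.exp (-x) :=
    fun a b hab => neg_injective (Real.exp_injective hab)
  refine (((p.roots.toFinset : Finset ℝ) : Set ℝ).toFinite.preimage hinj.injOn).subset ?_
  intro x hx
  have hx' : lsCriterion y d n x = c := hx
  have hexp (h : ℕ) : Real.exp (-x) ^ h = Real.exp (-(x * h)) := by
    rw [← Real.exp_nat_mul]; congr 1; ring
  simp only [Set.mem_preimage, Finset.mem_coe, Multiset.mem_toFinset, Polynomial.mem_roots hp0,
    Polynomial.IsRoot, hp, hexp]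
  exact sub_eq_zero.2 hx'

lemma finite_lsArgmin (K : Set ℝ) (y : ℕ → ℝ) {d : ℕ} (hd : 1 ≤ d) (n : ℕ) :
    (lsArgmin K y d n).Finite := by
  rcases (lsArgmin K y d n).eq_empty_or_nonempty with h | ⟨x, hx⟩
  · rw [h]; exact Set.finite_empty
  · refine (finite_setOf_lsCriterion_eq y hd n (lsCriterion y d n x)).subset fun z hz => ?_
    exact le_antisymm (hz.2 hx.1) (hx.2 hz.1)

lemma exists_nhds_inter_eq_singleton {A : Set ℝ} (hA : A.Finite) {x : ℝ} (hx : x ∈ A) :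
    ∃ U ∈ 𝓝 x, A ∩ U = {x} := by
  refine ⟨(A \ {x})ᶜ, (hA.sdiff).isClosed.isOpen_compl.mem_nhds (by simp), ?_⟩
  ext z
  simp only [Set.mem_inter_iff, Set.mem_compl_iff, Set.mem_sdiff, Set.mem_singleton_iff]
  constructor
  · rintro ⟨h1, h2⟩
    by_contra h3
    exact h2 ⟨h1, h3⟩
  · rintro rfl
    exact ⟨hx, by simp⟩

lemma tendsto_lsCriterion_true {y : ℕ → ℝ} {lam : ℝ} (d : ℕ)
    (hρ : ∀ h : ℕ, Tendsto (fun n => sampleAutocorr y n h) atTop (𝓝 (Real.exp (-(lam * h))))) :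
    Tendsto (fun n => lsCriterion y d n lam) atTop (𝓝 0) := by
  have : Tendsto (fun n => lsCriterion y d n lam) atTop (𝓝 (∑ h ∈ Finset.Icc 1 d,
      (Real.exp (-(lam * h)) - Real.exp (-(lam * h))) ^ 2)) :=
    tendsto_finsetSum _ fun h _ => ((hρ h).sub_const _).pow 2
  simpa using this

/-- The minimizers concentrate at the true parameter, uniformly over the whole argmin set: the
`h = 1` term of the criterion at a minimizer is at most the criterion at the true parameter. -/
lemma eventually_lsArgmin_exp_close {K : Set ℝ} {y : ℕ → ℝ} {lam : ℝ} (hlam : lam ∈ K) {d : ℕ}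
    (hd : 1 ≤ d)
    (hρ : ∀ h : ℕ, Tendsto (fun n => sampleAutocorr y n h) atTop (𝓝 (Real.exp (-(lam * h)))))
    {δ : ℝ} (hδ : 0 < δ) :
    ∀ᶠ n in atTop, ∀ x ∈ lsArgmin K y d n, |Real.exp (-x) - Real.exp (-lam)| < δ := by
  have h1 := hρ 1
  have h0 := tendsto_lsCriterion_true d hρ
  have e1 : ∀ᶠ n in atTop, |sampleAutocorr y n 1 - Real.exp (-lam)| < δ / 2 := by
    have := (Metric.tendsto_atTop.1 h1) (δ / 2) (half_pos hδ)
    obtain ⟨N, hN⟩ := this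
    filter_upwards [eventually_ge_atTop N] with n hn
    simpa [Real.dist_eq] using hN n hn
  have e0 : ∀ᶠ n in atTop, lsCriterion y d n lam < (δ / 2) ^ 2 :=
    h0.eventually_lt_const (by positivity)
  filter_upwards [e1, e0] with n hn1 hn0 x hx
  have h2 : (sampleAutocorr y n 1 - Real.exp (-x)) ^ 2 ≤ lsCriterion y d n x := by
    have := Finset.single_le_sum
      (f := fun h : ℕ => (sampleAutocorr y n h - Real.exp (-(x * h))) ^ 2)
      (fun h _ => sq_nonneg _) (Finset.mem_Icc.2 ⟨le_rfl, hd⟩)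
    simpa [lsCriterion] using this
  have h3 : lsCriterion y d n x ≤ lsCriterion y d n lam := hx.2 hlam
  have h4 : |sampleAutocorr y n 1 - Real.exp (-x)| < δ / 2 :=
    abs_lt_of_sq_lt_sq (by linarith) (by positivity)
  rw [abs_lt] at *
  constructor <;> linarith [h4.1, h4.2, hn1.1, hn1.2]

lemma tendsto_of_mem_lsArgmin {K : Set ℝ} {y : ℕ → ℝ} {lam : ℝ} (hlam : lam ∈ K) {d : ℕ}
    (hd : 1 ≤ d)
    (hρ : ∀ h : ℕ, Tendsto (fun n => sampleAutocorr y n h) atTop (𝓝 (Real.exp (-(lam * h)))))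
    {x : ℕ → ℝ} (hx : ∀ n, x n ∈ lsArgmin K y d n) : Tendsto x atTop (𝓝 lam) := by
  have h : Tendsto (fun n => Real.exp (-(x n))) atTop (𝓝 (Real.exp (-lam))) := by
    rw [Metric.tendsto_atTop]
    intro δ hδ
    obtain ⟨N, hN⟩ := eventually_atTop.1 (eventually_lsArgmin_exp_close hlam hd hρ hδ)
    exact ⟨N, fun n hn => hN n hn _ (hx n)⟩
  have h2 := (h.log (Real.exp_pos _).ne').neg
  simpa using h2

/-- The convexity defect of `z ↦ z ^ h` at the midpoint is nonnegative and at most quadratic. -/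
lemma midpoint_pow_defect {z w : ℝ} (hz0 : 0 ≤ z) (hz1 : z ≤ 1) (hw0 : 0 ≤ w) (hw1 : w ≤ 1)
    (h : ℕ) :
    0 ≤ (z ^ h + w ^ h) / 2 - ((z + w) / 2) ^ h ∧
      (z ^ h + w ^ h) / 2 - ((z + w) / 2) ^ h ≤ h ^ 2 * (z - w) ^ 2 := by
  have key (h : ℕ) : 0 ≤ (z - w) * (z ^ h - w ^ h) ∧
      (z - w) * (z ^ h - w ^ h) ≤ h * (z - w) ^ 2 := by
    rw [← (Commute.all z w).mul_geom_sum₂ h]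
    have e0 : 0 ≤ ∑ i ∈ Finset.range h, z ^ i * w ^ (h - 1 - i) :=
      Finset.sum_nonneg fun i _ => by positivity
    have e1 : ∑ i ∈ Finset.range h, z ^ i * w ^ (h - 1 - i) ≤ h := by
      calc _ ≤ ∑ i ∈ Finset.range h, (1 : ℝ) := Finset.sum_le_sum fun i _ =>
            mul_le_one₀ (pow_le_one₀ hz0 hz1) (by positivity) (pow_le_one₀ hw0 hw1)
        _ = h := by simp
    constructor <;> nlinarith [sq_nonneg (z - w), mul_nonneg e0 (sq_nonneg (z - w))]
  induction h with
  | zero => norm_num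
  | succ h ih =>
    obtain ⟨i0, i1⟩ := ih
    obtain ⟨k0, k1⟩ := key h
    have e : (z ^ (h + 1) + w ^ (h + 1)) / 2 - ((z + w) / 2) ^ (h + 1) =
        (z + w) / 2 * ((z ^ h + w ^ h) / 2 - ((z + w) / 2) ^ h) +
          (z - w) * (z ^ h - w ^ h) / 4 := by ring
    have m0 : 0 ≤ (z + w) / 2 := by linarith
    have m1 : (z + w) / 2 ≤ 1 := by linarith
    rw [e]
    constructor
    · positivity
    · have := mul_le_of_le_one_left i0 m1
      push_cast
      nlinarith [sq_nonneg (z - w), mul_nonneg (Nat.cast_nonneg (α := ℝ) h) (sq_nonneg (z - w))]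

/-- If `K` is an interval near the true parameter, two minimizers close to it would both be beaten
by the point whose exponential is the midpoint of theirs. -/
lemma eventually_existsUnique_lsArgmin {K : Set ℝ} (hK : IsCompact K) (hK0 : K ⊆ Set.Ici 0)
    {y : ℕ → ℝ} {lam : ℝ} (hlam : lam ∈ K) {d : ℕ} (hd : 1 ≤ d)
    (hρ : ∀ h : ℕ, Tendsto (fun n => sampleAutocorr y n h) atTop (𝓝 (Real.exp (-(lam * h)))))
    {ε : ℝ} (hε : 0 < ε) (hord : (K ∩ Set.Icc (lam - ε) (lam + ε)).OrdConnected) :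
    ∀ᶠ n in atTop, ∃! x, x ∈ lsArgmin K y d n := by
  -- `κ` bounds the deviations so that the convexity of the `h = 1` term outweighs the other defects
  let C : ℝ := ∑ h ∈ Finset.Icc 1 d, 4 * (h : ℝ) ^ 2
  have hC : 0 ≤ C := Finset.sum_nonneg fun h _ => by positivity
  let κ : ℝ := 1 / (4 * (C + 1))
  have hκ : 0 < κ := by positivity
  have hcont : ∀ h : ℕ, ∃ δ > 0, ∀ z : ℝ, |z - Real.exp (-lam)| < δ →
      |z ^ h - Real.exp (-(lam * h))| < κ := by
    intro h
    have hexp : Real.exp (-lam) ^ h = Real.exp (-(lam * h)) := by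
      rw [← Real.exp_nat_mul]; congr 1; ring
    have := (continuous_pow (M := ℝ) h).continuousAt (x := Real.exp (-lam))
    obtain ⟨δ, hδ, H⟩ := Metric.continuousAt_iff.1 this κ hκ
    refine ⟨δ, hδ, fun z hz => ?_⟩
    have := H (x := z) (by simpa [Real.dist_eq] using hz)
    simpa [Real.dist_eq, hexp] using this
  choose δ hδ0 hδ using hcont
  obtain ⟨η, hη0, hη⟩ : ∃ η > 0, ∀ h ∈ Finset.Icc 1 d, η ≤ δ h := by
    refine ⟨(Finset.Icc 1 d).inf' ⟨1, Finset.mem_Icc.2 ⟨le_rfl, hd⟩⟩ δ, ?_,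
      fun h hh => Finset.inf'_le _ hh⟩
    exact (Finset.lt_inf'_iff _).2 fun h _ => hδ0 h
  -- closeness of the exponentials that forces closeness of the parameters
  obtain ⟨τ, hτ0, hτ⟩ : ∃ τ > 0, ∀ x : ℝ, |Real.exp (-x) - Real.exp (-lam)| < τ →
      x ∈ Set.Icc (lam - ε) (lam + ε) := by
    refine ⟨min (Real.exp (-lam) - Real.exp (-(lam + ε)))
      (Real.exp (-(lam - ε)) - Real.exp (-lam)), ?_, fun x hx => ?_⟩
    · rw [gt_iff_lt, lt_min_iff, sub_pos, sub_pos, Real.exp_lt_exp, Real.exp_lt_exp]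
      constructor <;> linarith
    · rw [lt_min_iff, abs_lt, abs_lt] at hx
      have a1 : Real.exp (-(lam + ε)) < Real.exp (-x) := by linarith [hx.1.1]
      have a2 : Real.exp (-x) < Real.exp (-(lam - ε)) := by linarith [hx.2.2]
      rw [Real.exp_lt_exp] at a1 a2
      constructor <;> linarith
  have eρ : ∀ᶠ n in atTop, ∀ h ∈ Finset.Icc 1 d,
      |sampleAutocorr y n h - Real.exp (-(lam * h))| < κ := by
    rw [Finset.eventually_all]
    intro h _
    obtain ⟨N, hN⟩ := Metric.tendsto_atTop.1 (hρ h) κ hκ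
    filter_upwards [eventually_ge_atTop N] with n hn
    simpa [Real.dist_eq] using hN n hn
  filter_upwards [eρ, eventually_lsArgmin_exp_close hlam hd hρ hη0,
    eventually_lsArgmin_exp_close hlam hd hρ hτ0] with n hn1 hn2 hn3
  obtain ⟨x, hx⟩ := lsArgmin_nonempty hK ⟨lam, hlam⟩ y d n
  refine ⟨x, hx, fun w hw => ?_⟩
  by_contra hne
  have hz1 : Real.exp (-x) ≤ 1 := Real.exp_le_one_iff.2 (by linarith [Set.mem_Ici.1 (hK0 hx.1)])
  have hw1 : Real.exp (-w) ≤ 1 := Real.exp_le_one_iff.2 (by linarith [Set.mem_Ici.1 (hK0 hw.1)])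
  set z := Real.exp (-x) with hz
  set v := Real.exp (-w) with hv
  have hz0 : 0 < z := Real.exp_pos _
  have hv0 : 0 < v := Real.exp_pos _
  have hzv : z ≠ v := fun h => hne (neg_injective (Real.exp_injective (hv ▸ hz ▸ h))).symm
  let m : ℝ := -Real.log ((z + v) / 2)
  have hm0 : 0 < (z + v) / 2 := by positivity
  have hm : Real.exp (-m) = (z + v) / 2 := by simp only [m, neg_neg]; exact Real.exp_log hm0
  have hmK : m ∈ K := by
    have hord' := hord.uIcc_subset ⟨hx.1, hτ x (hn3 x hx)⟩ ⟨hw.1, hτ w (hn3 w hw)⟩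
    refine (hord' ?_).1
    rw [Set.mem_uIcc]
    rcases le_total z v with h | h
    · right
      have b1 : Real.exp (-x) ≤ Real.exp (-m) := by rw [hm, ← hz]; linarith
      have b2 : Real.exp (-m) ≤ Real.exp (-w) := by rw [hm, ← hv]; linarith
      rw [Real.exp_le_exp] at b1 b2
      constructor <;> linarith
    · left
      have b1 : Real.exp (-m) ≤ Real.exp (-x) := by rw [hm, ← hz]; linarith
      have b2 : Real.exp (-w) ≤ Real.exp (-m) := by rw [hm, ← hv]; linarith
      rw [Real.exp_le_exp] at b1 b2
      constructor <;> linarith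
  have hxm : lsCriterion y d n x ≤ lsCriterion y d n m := hx.2 hmK
  have hwm : lsCriterion y d n w ≤ lsCriterion y d n m := hw.2 hmK
  have hpow (u : ℝ) (h : ℕ) : Real.exp (-(u * h)) = Real.exp (-u) ^ h := by
    rw [← Real.exp_nat_mul]; congr 1; ring
  have hcrit (u : ℝ) : lsCriterion y d n u =
      ∑ h ∈ Finset.Icc 1 d, (sampleAutocorr y n h - Real.exp (-u) ^ h) ^ 2 := by
    simp only [lsCriterion, hpow]
  have hdiff : lsCriterion y d n x + lsCriterion y d n w - 2 * lsCriterion y d n m =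
      ∑ h ∈ Finset.Icc 1 d, ((z ^ h - v ^ h) ^ 2 / 2 +
        2 * ((z ^ h + v ^ h) / 2 - ((z + v) / 2) ^ h) *
          ((z ^ h + v ^ h) / 2 + ((z + v) / 2) ^ h - 2 * sampleAutocorr y n h)) := by
    rw [hcrit, hcrit, hcrit, hm, ← hz, ← hv, Finset.mul_sum, ← Finset.sum_add_distrib,
      ← Finset.sum_sub_distrib]
    exact Finset.sum_congr rfl fun h _ => by ring
  have hmid : |(z + v) / 2 - Real.exp (-lam)| < η := by
    have c1 := hn2 x hx
    have c2 := hn2 w hw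
    rw [← hz] at c1
    rw [← hv] at c2
    rw [abs_lt] at *
    constructor <;> linarith [c1.1, c1.2, c2.1, c2.2]
  have hterm : ∀ h ∈ Finset.Icc 1 d, -(2 * κ * (4 * (h : ℝ) ^ 2) * (z - v) ^ 2) ≤
      2 * ((z ^ h + v ^ h) / 2 - ((z + v) / 2) ^ h) *
        ((z ^ h + v ^ h) / 2 + ((z + v) / 2) ^ h - 2 * sampleAutocorr y n h) := by
    intro h hh
    obtain ⟨p0, p1⟩ := midpoint_pow_defect hz0.le hz1 hv0.le hw1 h
    have c0 := hn1 h hh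
    have c1 := hδ h z ((hn2 x hx).trans_le (hη h hh))
    have c2 := hδ h v ((hn2 w hw).trans_le (hη h hh))
    have c3 := hδ h ((z + v) / 2) (hmid.trans_le (hη h hh))
    rw [abs_lt] at c0 c1 c2 c3
    have hb : -(4 * κ) ≤ (z ^ h + v ^ h) / 2 + ((z + v) / 2) ^ h - 2 * sampleAutocorr y n h := by
      linarith [c0.2, c1.1, c2.1, c3.1]
    nlinarith [mul_le_mul_of_nonneg_left hb p0, mul_le_mul_of_nonneg_left p1 hκ.le]
  have hlow : (z - v) ^ 2 / 2 - 2 * κ * C * (z - v) ^ 2 ≤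
      lsCriterion y d n x + lsCriterion y d n w - 2 * lsCriterion y d n m := by
    rw [hdiff, Finset.sum_add_distrib]
    have s1 := Finset.single_le_sum (f := fun h => (z ^ h - v ^ h) ^ 2 / 2)
      (fun h _ => by positivity) (Finset.mem_Icc.2 ⟨le_rfl, hd⟩)
    have s2 := Finset.sum_le_sum hterm
    have s3 : ∑ h ∈ Finset.Icc 1 d, -(2 * κ * (4 * (h : ℝ) ^ 2) * (z - v) ^ 2) =
        -(2 * κ * C * (z - v) ^ 2) := by
      simp only [C, Finset.mul_sum, Finset.sum_mul, Finset.sum_neg_distrib]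
    simp only [pow_one] at s1
    linarith
  have hpos : 0 < (z - v) ^ 2 := by
    have := sub_ne_zero.2 hzv
    positivity
  have hκ1 : κ * (C + 1) = 1 / 4 := by simp only [κ]; field_simp
  nlinarith [mul_pos hκ hpos]

/-! ### Sample autocorrelations along an autoregressive sequence -/

lemma tendsto_zero_of_le_mul_add {a b : ℕ → ℝ} {φ : ℝ} (hφ0 : 0 ≤ φ) (hφ1 : φ < 1)
    (ha : ∀ n, 0 ≤ a n) (hab : ∀ n, a (n + 1) ≤ φ * a n + b n) (hb : Tendsto b atTop (𝓝 0)) :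
    Tendsto a atTop (𝓝 0) := by
  rw [Metric.tendsto_atTop]
  intro ε hε
  have hc : 0 < ε / 2 * (1 - φ) := mul_pos (half_pos hε) (by linarith)
  obtain ⟨N, hN⟩ := eventually_atTop.1 (hb.eventually_lt_const hc)
  have hstep (k : ℕ) : a (N + k) - ε / 2 ≤ φ ^ k * |a N - ε / 2| := by
    induction k with
    | zero => simpa using le_abs_self (a N - ε / 2)
    | succ k ih =>
      have h1 := hab (N + k)
      have h2 := hN (N + k) (Nat.le_add_right _ _)
      have h3 := mul_le_mul_of_nonneg_left ih hφ0
      rw [← add_assoc, pow_succ]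
      nlinarith
  have hgeo : Tendsto (fun k : ℕ => φ ^ k * |a N - ε / 2|) atTop (𝓝 0) := by
    simpa using (tendsto_pow_atTop_nhds_zero_of_lt_one hφ0 hφ1).mul_const |a N - ε / 2|
  obtain ⟨M, hM⟩ := eventually_atTop.1 (hgeo.eventually_lt_const (half_pos hε))
  refine ⟨N + M, fun n hn => ?_⟩
  obtain ⟨k, rfl⟩ := Nat.exists_eq_add_of_le (show N ≤ n by omega)
  have := hM k (by omega)
  rw [Real.dist_eq, sub_zero, abs_of_nonneg (ha _)]
  linarith [hstep k]

/-- If the averages of `u` converge, then `u n = o(n)`. -/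
lemma tendsto_div_of_tendsto_average {u : ℕ → ℝ} {l : ℝ}
    (hu : Tendsto (fun n : ℕ => (∑ i ∈ Finset.range n, u i) / n) atTop (𝓝 l)) :
    Tendsto (fun n : ℕ => u n / (n + 1 : ℕ)) atTop (𝓝 0) := by
  have h1 := hu.comp (tendsto_add_atTop_nat 1)
  have h2 : Tendsto (fun n : ℕ => (n : ℝ) / (n + 1 : ℕ)) atTop (𝓝 1) := by
    simpa using tendsto_natCast_div_add_atTop (𝕜 := ℝ) 1
  have h3 := h1.sub (hu.mul h2)
  rw [mul_one, sub_self] at h3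
  refine h3.congr' ?_
  filter_upwards [eventually_gt_atTop 0] with n hn
  have hn' : (n : ℝ) ≠ 0 := by positivity
  have hn1 : ((n + 1 : ℕ) : ℝ) ≠ 0 := by positivity
  simp only [Function.comp_apply, Finset.sum_range_succ]
  field_simp
  ring

/-- Dropping the last `h` terms of a sum does not change the limit of its averages. -/
lemma tendsto_average_sub {u : ℕ → ℝ} {l : ℝ} (h : ℕ)
    (hu : Tendsto (fun n : ℕ => (∑ i ∈ Finset.range n, u i) / n) atTop (𝓝 l)) :
    Tendsto (fun n : ℕ => (∑ i ∈ Finset.range (n - h), u i) / n) atTop (𝓝 l) := by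
  rw [← tendsto_add_atTop_iff_nat h]
  simp only [Nat.add_sub_cancel]
  have h2 : Tendsto (fun n : ℕ => (n : ℝ) / ((n + h : ℕ) : ℝ)) atTop (𝓝 1) := by
    simpa using tendsto_natCast_div_add_atTop (𝕜 := ℝ) (h : ℝ)
  have h3 := hu.mul h2
  rw [mul_one] at h3
  refine h3.congr' ?_
  filter_upwards [eventually_gt_atTop 0] with n hn
  have hn' : (n : ℝ) ≠ 0 := by positivity
  field_simp

/-- Dropping the first `h` terms of a sum does not change the limit of its averages. -/
lemma tendsto_average_shift {u : ℕ → ℝ} {l : ℝ} (h : ℕ)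
    (hu : Tendsto (fun n : ℕ => (∑ i ∈ Finset.range n, u i) / n) atTop (𝓝 l)) :
    Tendsto (fun n : ℕ => (∑ i ∈ Finset.range (n - h), u (i + h)) / n) atTop (𝓝 l) := by
  have h0 : Tendsto (fun n : ℕ => (∑ i ∈ Finset.range h, u i) / (n : ℝ)) atTop (𝓝 0) :=
    tendsto_const_div_atTop_nhds_zero_nat _
  have h1 := hu.sub h0
  rw [sub_zero] at h1
  refine h1.congr' ?_
  filter_upwards [eventually_ge_atTop h] with n hn
  rw [← sub_div]
  congr 1
  obtain ⟨k, rfl⟩ := Nat.exists_eq_add_of_le hn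
  rw [Finset.sum_range_add, add_sub_cancel_left, Nat.add_sub_cancel_left]
  exact Finset.sum_congr rfl fun i _ => by rw [add_comm]

section Autoregression

variable {W η : ℕ → ℝ} {φ s : ℝ}

lemma tendsto_sq_div_of_ar (hφ0 : 0 ≤ φ) (hφ1 : φ < 1) (hW : ∀ i, W (i + 1) = φ * W i + η i)
    (h2 : Tendsto (fun n : ℕ => (∑ i ∈ Finset.range n, η i ^ 2) / n) atTop (𝓝 s)) :
    Tendsto (fun n : ℕ => W n ^ 2 / n) atTop (𝓝 0) := by
  have hb := (tendsto_div_of_tendsto_average h2).div_const (1 - φ)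
  rw [zero_div] at hb
  have hφ : 0 < 1 - φ := by linarith
  rw [← tendsto_add_atTop_iff_nat 1]
  have hb' := hb.comp (tendsto_add_atTop_nat 1)
  refine tendsto_zero_of_le_mul_add hφ0 hφ1 (fun n => by positivity) (fun n => ?_) hb'
  simp only [Function.comp_apply]
  -- convexity of the square
  have hconv : W (n + 1 + 1) ^ 2 ≤ φ * W (n + 1) ^ 2 + η (n + 1) ^ 2 / (1 - φ) := by
    rw [hW (n + 1), ← sub_nonneg]
    have : φ * W (n + 1) ^ 2 + η (n + 1) ^ 2 / (1 - φ) - (φ * W (n + 1) + η (n + 1)) ^ 2 =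
        φ / (1 - φ) * ((1 - φ) * W (n + 1) - η (n + 1)) ^ 2 := by
      field_simp
      ring
    rw [this]
    positivity
  have hn1 : (0 : ℝ) < ((n + 1 : ℕ) : ℝ) := by positivity
  have hn2 : (0 : ℝ) < ((n + 1 + 1 : ℕ) : ℝ) := by positivity
  calc W (n + 1 + 1) ^ 2 / ((n + 1 + 1 : ℕ) : ℝ)
      ≤ (φ * W (n + 1) ^ 2 + η (n + 1) ^ 2 / (1 - φ)) / ((n + 1 + 1 : ℕ) : ℝ) := by gcongr
    _ = φ * (W (n + 1) ^ 2 / ((n + 1 + 1 : ℕ) : ℝ)) +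
        η (n + 1) ^ 2 / ((n + 1 + 1 : ℕ) : ℝ) / (1 - φ) := by
          field_simp
    _ ≤ φ * (W (n + 1) ^ 2 / ((n + 1 : ℕ) : ℝ)) +
        η (n + 1) ^ 2 / ((n + 1 + 1 : ℕ) : ℝ) / (1 - φ) := by
          gcongr
          omega

lemma tendsto_div_of_sq_div {a : ℕ → ℝ} (ha : Tendsto (fun n : ℕ => a n ^ 2 / n) atTop (𝓝 0)) :
    Tendsto (fun n : ℕ => a n / n) atTop (𝓝 0) := by
  have h : Tendsto (fun n : ℕ => (a n / n) ^ 2) atTop (𝓝 0) := by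
    have := ha.mul (tendsto_one_div_atTop_nhds_zero_nat (𝕜 := ℝ))
    rw [mul_zero] at this
    refine this.congr fun n => ?_
    rw [div_pow, div_mul_div_comm, mul_one, sq (n : ℝ)]
  have h2 := h.sqrt
  simp only [Real.sqrt_sq_eq_abs, Real.sqrt_zero] at h2
  exact (tendsto_zero_iff_abs_tendsto_zero _).2 h2

lemma tendsto_average_of_ar (hφ0 : 0 ≤ φ) (hφ1 : φ < 1) (hW : ∀ i, W (i + 1) = φ * W i + η i)
    (h1 : Tendsto (fun n : ℕ => (∑ i ∈ Finset.range n, η i) / n) atTop (𝓝 0))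
    (h2 : Tendsto (fun n : ℕ => (∑ i ∈ Finset.range n, η i ^ 2) / n) atTop (𝓝 s)) :
    Tendsto (fun n : ℕ => (∑ i ∈ Finset.range n, W i) / n) atTop (𝓝 0) := by
  have hφ : 1 - φ ≠ 0 := by linarith
  have hWn := tendsto_div_of_sq_div (tendsto_sq_div_of_ar hφ0 hφ1 hW h2)
  have hsum (n : ℕ) : (1 - φ) * ∑ i ∈ Finset.range n, W i =
      ∑ i ∈ Finset.range n, η i + W 0 - W n := by
    induction n with
    | zero => simp
    | succ n ih => rw [Finset.sum_range_succ, Finset.sum_range_succ, mul_add, ih, hW n]; ring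
  have h3 := (((h1.add (tendsto_const_div_atTop_nhds_zero_nat (W 0))).sub hWn).div_const (1 - φ))
  rw [show ((0 : ℝ) + 0 - 0) / (1 - φ) = 0 by simp] at h3
  refine h3.congr fun n => ?_
  rw [← add_div, ← sub_div, ← hsum n]
  field_simp

lemma tendsto_average_mul_of_ar (hφ0 : 0 ≤ φ) (hφ1 : φ < 1)
    (hW : ∀ i, W (i + 1) = φ * W i + η i)
    (h2 : Tendsto (fun n : ℕ => (∑ i ∈ Finset.range n, η i ^ 2) / n) atTop (𝓝 s))
    (h3 : ∀ h : ℕ, Tendsto (fun n : ℕ => (∑ i ∈ Finset.range n, η (i + h) * W i) / n) atTop (𝓝 0))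
    (h : ℕ) :
    Tendsto (fun n : ℕ => (∑ i ∈ Finset.range n, W (i + h) * W i) / n) atTop
      (𝓝 (φ ^ h * (s / (1 - φ ^ 2)))) := by
  induction h with
  | zero =>
    have hφ : 1 - φ ^ 2 ≠ 0 := by nlinarith
    have hWn := tendsto_sq_div_of_ar hφ0 hφ1 hW h2
    have hsum (n : ℕ) : (1 - φ ^ 2) * ∑ i ∈ Finset.range n, W (i + 0) * W i =
        ∑ i ∈ Finset.range n, η i ^ 2 + 2 * φ * ∑ i ∈ Finset.range n, η (i + 0) * W i +
          W 0 ^ 2 - W n ^ 2 := by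
      induction n with
      | zero => simp
      | succ n ih =>
        simp only [Finset.sum_range_succ, mul_add, hW n, add_zero] at ih ⊢
        linear_combination ih
    have h4 := ((((h2.add ((h3 0).const_mul (2 * φ))).add
      (tendsto_const_div_atTop_nhds_zero_nat (W 0 ^ 2))).sub hWn).div_const (1 - φ ^ 2))
    rw [show (s + 2 * φ * 0 + 0 - 0) / (1 - φ ^ 2) = φ ^ 0 * (s / (1 - φ ^ 2)) by simp] at h4
    refine h4.congr fun n => ?_
    rw [← mul_div_assoc, ← add_div, ← add_div, ← sub_div, ← hsum n]
    field_simp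
  | succ h ih =>
    have h4 := (ih.const_mul φ).add (h3 h)
    rw [add_zero, ← mul_assoc, ← pow_succ'] at h4
    refine h4.congr fun n => ?_
    rw [← mul_div_assoc, ← add_div, Finset.mul_sum, ← Finset.sum_add_distrib]
    congr 1
    refine Finset.sum_congr rfl fun i _ => ?_
    rw [← add_assoc, hW (i + h)]
    ring

/-- Deterministic core of the consistency of the sample autocorrelations: along an autoregressive
sequence whose innovations average to `0`, have asymptotic second moment `s > 0`, and are
asymptotically uncorrelated with the past, the lag-`h` autocorrelation converges to `φ ^ h`. -/
lemma tendsto_sampleAutocorr_of_ar {y : ℕ → ℝ} {c : ℝ} (hy : ∀ i, y (i + 1) = c + W i)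
    (hφ0 : 0 ≤ φ) (hφ1 : φ < 1) (hs : 0 < s) (hW : ∀ i, W (i + 1) = φ * W i + η i)
    (h1 : Tendsto (fun n : ℕ => (∑ i ∈ Finset.range n, η i) / n) atTop (𝓝 0))
    (h2 : Tendsto (fun n : ℕ => (∑ i ∈ Finset.range n, η i ^ 2) / n) atTop (𝓝 s))
    (h3 : ∀ h : ℕ, Tendsto (fun n : ℕ => (∑ i ∈ Finset.range n, η (i + h) * W i) / n) atTop (𝓝 0))
    (h : ℕ) : Tendsto (fun n => sampleAutocorr y n h) atTop (𝓝 (φ ^ h)) := by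
  have hγ : 0 < s / (1 - φ ^ 2) := div_pos hs (by nlinarith)
  have hmean := tendsto_average_of_ar hφ0 hφ1 hW h1 h2
  have hIcc (n : ℕ) (f : ℕ → ℝ) : ∑ i ∈ Finset.Icc 1 n, f i = ∑ i ∈ Finset.range n, f (i + 1) := by
    rw [Finset.range_eq_Ico, Finset.sum_Ico_add' f 0 n 1]
    rfl
  have hcov (h : ℕ) : Tendsto (fun n => sampleAutocov y n h) atTop
      (𝓝 (φ ^ h * (s / (1 - φ ^ 2)))) := by
    have a1 := tendsto_average_sub h (tendsto_average_mul_of_ar hφ0 hφ1 hW h2 h3 h)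
    have a2 := tendsto_average_sub h hmean
    have a3 := tendsto_average_shift h hmean
    have a4 : Tendsto (fun n : ℕ => (∑ i ∈ Finset.range (n - h), (1 : ℝ)) / n) atTop (𝓝 1) := by
      refine tendsto_average_sub h (u := fun _ => (1 : ℝ)) ?_
      refine tendsto_const_nhds.congr' ?_
      filter_upwards [eventually_gt_atTop 0] with n hn
      have hn' : (n : ℝ) ≠ 0 := by positivity
      simp [hn']
    have a5 := (a1.sub (hmean.mul (a2.add a3))).add (a4.mul (hmean.pow 2))
    rw [show φ ^ h * (s / (1 - φ ^ 2)) - 0 * (0 + 0) + 1 * 0 ^ 2 = φ ^ h * (s / (1 - φ ^ 2)) by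
      ring] at a5
    refine a5.congr' ?_
    filter_upwards [eventually_gt_atTop 0] with n hn
    have hn' : (n : ℝ) ≠ 0 := by positivity
    have hm : sampleMean y n = c + (∑ i ∈ Finset.range n, W i) / n := by
      rw [sampleMean, hIcc]
      simp only [hy, Finset.sum_add_distrib, Finset.sum_const, Finset.card_range, nsmul_eq_mul]
      field_simp
    set m := (∑ i ∈ Finset.range n, W i) / n with hmdef
    have e (i : ℕ) : (y (i + 1 + h) - sampleMean y n) * (y (i + 1) - sampleMean y n) =
        W (i + h) * W i - m * (W i + W (i + h)) + m ^ 2 * 1 := by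
      rw [hm, hy, show i + 1 + h = i + h + 1 by ring, hy]
      ring
    rw [sampleAutocov, hIcc]
    simp only [e, Finset.sum_add_distrib, Finset.sum_sub_distrib, ← Finset.mul_sum]
    field_simp
  have hfin := (hcov h).div (hcov 0) (by simpa using hγ.ne')
  rw [pow_zero, one_mul, mul_div_assoc, div_self hγ.ne', mul_one] at hfin
  exact hfin

end Autoregression

/-! ### A strong law for orthogonal random variables -/

section Orthogonal

variable {Ω : Type*} {mΩ : MeasurableSpace Ω} {P : Measure Ω}

lemma ae_tendsto_zero_of_summable_integral {f : ℕ → Ω → ℝ} (hf : ∀ k, Integrable (f k) P)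
    (hf0 : ∀ k ω, 0 ≤ f k ω) {b : ℕ → ℝ} (hb : Summable b) (hfb : ∀ k, ∫ ω, f k ω ∂P ≤ b k) :
    ∀ᵐ ω ∂P, Tendsto (fun k => f k ω) atTop (𝓝 0) := by
  have hmeas (k : ℕ) : AEMeasurable (fun ω => ENNReal.ofReal (f k ω)) P :=
    (hf k).1.aemeasurable.ennreal_ofReal
  have hfin : ∫⁻ ω, ∑' k, ENNReal.ofReal (f k ω) ∂P ≠ ∞ := by
    rw [lintegral_tsum hmeas]
    have hb0 (k : ℕ) : 0 ≤ b k := (integral_nonneg (hf0 k)).trans (hfb k)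
    refine ne_top_of_le_ne_top (hb.tsum_ofReal_ne_top) (ENNReal.tsum_le_tsum fun k => ?_)
    rw [← ofReal_integral_eq_lintegral_ofReal (hf k) (ae_of_all _ (hf0 k))]
    exact ENNReal.ofReal_le_ofReal (hfb k)
  filter_upwards [ae_lt_top' (AEMeasurable.tsum hmeas) hfin] with ω hω
  have h := ENNReal.tendsto_atTop_zero_of_tsum_ne_top hω.ne
  have h2 := (ENNReal.tendsto_toReal ENNReal.zero_ne_top).comp h
  simpa [Function.comp_def, ENNReal.toReal_ofReal (hf0 _ ω)] using h2

lemma integral_sq_sum_le_of_orthogonal {Z : ℕ → Ω → ℝ} {C : ℝ} (hZ : ∀ i, MemLp (Z i) 2 P)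
    (horth : ∀ i j, i < j → ∫ ω, Z i ω * Z j ω ∂P = 0) (hC : ∀ i, ∫ ω, Z i ω ^ 2 ∂P ≤ C) (n : ℕ) :
    ∫ ω, (∑ i ∈ Finset.range n, Z i ω) ^ 2 ∂P ≤ C * n := by
  induction n with
  | zero => simp
  | succ n ih =>
    have hS : MemLp (fun ω => ∑ i ∈ Finset.range n, Z i ω) 2 P :=
      memLp_finsetSum _ fun i _ => hZ i
    have hSZ : ∫ ω, (∑ i ∈ Finset.range n, Z i ω) * Z n ω ∂P = 0 := by
      have hi (i : ℕ) : Integrable (fun ω => Z i ω * Z n ω) P := (hZ i).integrable_mul (hZ n)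
      simp only [Finset.sum_mul]
      rw [integral_finsetSum _ fun i _ => hi i]
      exact Finset.sum_eq_zero fun i hi => horth i n (Finset.mem_range.1 hi)
    have e (ω : Ω) : (∑ i ∈ Finset.range (n + 1), Z i ω) ^ 2 =
        (∑ i ∈ Finset.range n, Z i ω) ^ 2 + 2 * ((∑ i ∈ Finset.range n, Z i ω) * Z n ω) +
          Z n ω ^ 2 := by
      rw [Finset.sum_range_succ]
      ring
    have i1 := hS.integrable_sq
    have i2 : Integrable (fun ω => 2 * ((∑ i ∈ Finset.range n, Z i ω) * Z n ω)) P :=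
      (hS.integrable_mul (hZ n)).const_mul 2
    have i12 : Integrable (fun ω => (∑ i ∈ Finset.range n, Z i ω) ^ 2 +
        2 * ((∑ i ∈ Finset.range n, Z i ω) * Z n ω)) P := i1.add i2
    simp only [e]
    rw [integral_add i12 (hZ n).integrable_sq, integral_add i1 i2, integral_const_mul, hSZ]
    push_cast
    linarith [hC n]

/-- Strong law of large numbers for orthogonal random variables with bounded second moments: along
the squares by summing second moments, and between consecutive squares by the triangle
inequality. -/
theorem ae_tendsto_average_of_orthogonal {Z : ℕ → Ω → ℝ} {C : ℝ} (hZ : ∀ i, MemLp (Z i) 2 P)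
    (horth : ∀ i j, i < j → ∫ ω, Z i ω * Z j ω ∂P = 0) (hC : ∀ i, ∫ ω, Z i ω ^ 2 ∂P ≤ C) :
    ∀ᵐ ω ∂P, Tendsto (fun n : ℕ => (∑ i ∈ Finset.range n, Z i ω) / n) atTop (𝓝 0) := by
  have hC0 : 0 ≤ C := (integral_nonneg fun ω => sq_nonneg (Z 0 ω)).trans (hC 0)
  -- `R k` dominates all the partial sums between the squares of `k + 1` and `k + 2`
  let R : ℕ → Ω → ℝ := fun k ω => |∑ i ∈ Finset.range ((k + 1) ^ 2), Z i ω| +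
    ∑ i ∈ Finset.Ico ((k + 1) ^ 2) ((k + 2) ^ 2), |Z i ω|
  have hR0 (k ω) : 0 ≤ R k ω :=
    add_nonneg (abs_nonneg _) (Finset.sum_nonneg fun i _ => abs_nonneg _)
  have hRL (k : ℕ) : MemLp (R k) 2 P :=
    (memLp_finsetSum _ fun i _ => hZ i).abs.add (memLp_finsetSum _ fun i _ => (hZ i).abs)
  have hcard (k : ℕ) : (Finset.Ico ((k + 1) ^ 2) ((k + 2) ^ 2)).card = 2 * k + 3 := by
    rw [Nat.card_Ico]
    have : (k + 2) ^ 2 = (k + 1) ^ 2 + (2 * k + 3) := by ring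
    omega
  have hRi (k : ℕ) : ∫ ω, R k ω ^ 2 ∂P ≤ 20 * C * ((k : ℝ) + 1) ^ 2 := by
    have hpt (ω : Ω) : R k ω ^ 2 ≤ 2 * (∑ i ∈ Finset.range ((k + 1) ^ 2), Z i ω) ^ 2 +
        2 * ((2 * k + 3) * ∑ i ∈ Finset.Ico ((k + 1) ^ 2) ((k + 2) ^ 2), Z i ω ^ 2) := by
      have h1 := sq_sum_le_card_mul_sum_sq (s := Finset.Ico ((k + 1) ^ 2) ((k + 2) ^ 2))
        (f := fun i => |Z i ω|)
      rw [hcard] at h1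
      simp only [sq_abs] at h1
      push_cast at h1
      have h2 := add_sq_le (a := |∑ i ∈ Finset.range ((k + 1) ^ 2), Z i ω|)
        (b := ∑ i ∈ Finset.Ico ((k + 1) ^ 2) ((k + 2) ^ 2), |Z i ω|)
      rw [sq_abs] at h2
      simp only [R]
      linarith
    have i1 : Integrable (fun ω => 2 * (∑ i ∈ Finset.range ((k + 1) ^ 2), Z i ω) ^ 2) P :=
      (memLp_finsetSum _ fun i _ => hZ i).integrable_sq.const_mul 2
    have i2 : Integrable (fun ω => ∑ i ∈ Finset.Ico ((k + 1) ^ 2) ((k + 2) ^ 2), Z i ω ^ 2) P :=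
      integrable_finsetSum _ fun i _ => (hZ i).integrable_sq
    have i3 : Integrable (fun ω =>
        2 * ((2 * (k : ℝ) + 3) * ∑ i ∈ Finset.Ico ((k + 1) ^ 2) ((k + 2) ^ 2), Z i ω ^ 2)) P :=
      (i2.const_mul _).const_mul 2
    refine (integral_mono (hRL k).integrable_sq (i1.add i3) hpt).trans ?_
    simp only [Pi.add_apply]
    rw [integral_add i1 i3, integral_const_mul, integral_const_mul, integral_const_mul,
      integral_finsetSum _ fun i _ => (hZ i).integrable_sq]
    have h1 := integral_sq_sum_le_of_orthogonal hZ horth hC ((k + 1) ^ 2)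
    have h2 := Finset.sum_le_card_nsmul (Finset.Ico ((k + 1) ^ 2) ((k + 2) ^ 2))
      (fun i => ∫ ω, Z i ω ^ 2 ∂P) C fun i _ => hC i
    rw [hcard, nsmul_eq_mul] at h2
    push_cast at h1 h2
    have h3 := mul_le_mul_of_nonneg_left h2 (show (0 : ℝ) ≤ 2 * k + 3 by positivity)
    have hk : (0 : ℝ) ≤ k := Nat.cast_nonneg k
    have h4 : (2 * (k : ℝ) + 3) ^ 2 ≤ 9 * ((k : ℝ) + 1) ^ 2 := by nlinarith
    nlinarith [mul_le_mul_of_nonneg_left h4 hC0]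
  have hae := ae_tendsto_zero_of_summable_integral (P := P)
    (f := fun k ω => R k ω ^ 2 / ((k : ℝ) + 1) ^ 4) (b := fun k => 20 * C * (1 / ((k : ℝ) + 1) ^ 2))
    (fun k => (hRL k).integrable_sq.div_const _) (fun k ω => by positivity)
    (by
      have := (summable_nat_add_iff 1).2 (Real.summable_one_div_nat_pow.2 one_lt_two)
      push_cast at this
      exact this.mul_left _)
    (fun k => by
      rw [integral_div, div_le_iff₀ (by positivity)]
      refine (hRi k).trans_eq ?_
      field_simp)
  filter_upwards [hae] with ω hω
  have hR : Tendsto (fun k : ℕ => R k ω / ((k : ℝ) + 1) ^ 2) atTop (𝓝 0) := by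
    have := hω.sqrt
    rw [Real.sqrt_zero] at this
    refine this.congr fun k => ?_
    rw [show R k ω ^ 2 / ((k : ℝ) + 1) ^ 4 = (R k ω / ((k : ℝ) + 1) ^ 2) ^ 2 by
      rw [div_pow]; ring]
    exact Real.sqrt_sq (div_nonneg (hR0 k ω) (by positivity))
  have hsqrt : Tendsto (fun n : ℕ => Nat.sqrt n - 1) atTop atTop := by
    refine tendsto_atTop.2 fun b => ?_
    filter_upwards [eventually_ge_atTop ((b + 1) * (b + 1))] with n hn
    have := Nat.le_sqrt.2 hn
    omega
  refine squeeze_zero_norm' ?_ (hR.comp hsqrt)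
  filter_upwards [eventually_ge_atTop 1] with n hn
  obtain ⟨k, hk⟩ : ∃ k, Nat.sqrt n = k + 1 :=
    ⟨Nat.sqrt n - 1, by have := Nat.le_sqrt.2 (show 1 * 1 ≤ n by omega); omega⟩
  have hk1 : (k + 1) ^ 2 ≤ n := hk ▸ Nat.sqrt_le' n
  have hk2 : n < (k + 2) ^ 2 := by have := Nat.lt_succ_sqrt' n; rwa [hk] at this
  simp only [Function.comp_apply, hk, Nat.add_sub_cancel, Real.norm_eq_abs, abs_div, Nat.abs_cast]
  have hk1' : ((k : ℝ) + 1) ^ 2 ≤ n := by exact_mod_cast hk1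
  refine div_le_div₀ (hR0 k ω) ?_ (by positivity) hk1'
  rw [Finset.range_eq_Ico, ← Finset.sum_Ico_consecutive _ (Nat.zero_le _) hk1,
    ← Finset.range_eq_Ico]
  refine (abs_add_le _ _).trans (add_le_add le_rfl ((Finset.abs_sum_le_sum_abs _ _).trans ?_))
  exact Finset.sum_le_sum_of_subset_of_nonneg (Finset.Ico_subset_Ico_right hk2.le)
    fun i _ _ => abs_nonneg _

end Orthogonal

/-! ### Autoregressive processes with independent innovations -/

section AutoregressiveProcess

variable {Ω : Type*} {mΩ : MeasurableSpace Ω} {P : Measure Ω}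

lemma indepFun_of_indep_of_measurable {β : Type*} [MeasurableSpace β] {m : MeasurableSpace Ω}
    {X : Ω → ℝ} {f : Ω → β}
    (h : Indep (MeasurableSpace.comap X inferInstance) m P) (hf : Measurable[m] f) :
    IndepFun X f P := by
  rw [IndepFun_iff_Indep]
  exact indep_of_indep_of_le_right h hf.comap_le

/-- The autoregressive process with coefficient `φ` and innovations `η`, started at `0`. -/
noncomputable def arProcess (φ : ℝ) (η : ℕ → Ω → ℝ) : ℕ → Ω → ℝ
  | 0 => 0
  | i + 1 => φ • arProcess φ η i + η i

/-- A sequence `η` of centred, identically distributed, square integrable random variables such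
that `η i` is `𝓖 (i + 1)`-measurable and independent of `𝓖 i`. -/
structure IsInnovation (P : Measure Ω) (𝓖 : Filtration ℕ mΩ) (η : ℕ → Ω → ℝ) : Prop where
  measurable_succ : ∀ i, Measurable[𝓖 (i + 1)] (η i)
  indep : ∀ i, Indep (MeasurableSpace.comap (η i) inferInstance) (𝓖 i) P
  identDistrib : ∀ i, IdentDistrib (η i) (η 0) P P
  memLp_zero : MemLp (η 0) 2 P
  integral_zero : ∫ ω, η 0 ω ∂P = 0

namespace IsInnovation

variable {𝓖 : Filtration ℕ mΩ} {η : ℕ → Ω → ℝ}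

lemma measurable (hη : IsInnovation P 𝓖 η) (i : ℕ) : Measurable (η i) :=
  (hη.measurable_succ i).mono (𝓖.le _) le_rfl

lemma memLp (hη : IsInnovation P 𝓖 η) (i : ℕ) : MemLp (η i) 2 P :=
  (hη.identDistrib i).memLp_iff.2 hη.memLp_zero

lemma integral_eq_zero (hη : IsInnovation P 𝓖 η) (i : ℕ) : ∫ ω, η i ω ∂P = 0 :=
  (hη.identDistrib i).integral_eq.trans hη.integral_zero

lemma integral_sq_eq (hη : IsInnovation P 𝓖 η) (i : ℕ) :
    ∫ ω, η i ω ^ 2 ∂P = ∫ ω, η 0 ω ^ 2 ∂P :=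
  ((hη.identDistrib i).comp (measurable_id.pow_const 2)).integral_eq

lemma integral_mul_eq_zero (hη : IsInnovation P 𝓖 η) {i : ℕ} {B : Ω → ℝ}
    (hB : Measurable[𝓖 i] B) : ∫ ω, η i ω * B ω ∂P = 0 := by
  rw [(indepFun_of_indep_of_measurable (hη.indep i) hB).integral_fun_mul_eq_mul_integral
    (hη.measurable i).aestronglyMeasurable (hB.mono (𝓖.le i) le_rfl).aestronglyMeasurable,
    hη.integral_eq_zero, zero_mul]

lemma ae_tendsto_average_sq (hη : IsInnovation P 𝓖 η) :
    ∀ᵐ ω ∂P, Tendsto (fun n : ℕ => (∑ i ∈ Finset.range n, η i ω ^ 2) / n) atTop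
      (𝓝 (∫ ω, η 0 ω ^ 2 ∂P)) := by
  refine strong_law_ae_real (fun i ω => η i ω ^ 2) hη.memLp_zero.integrable_sq ?_
    fun i => (hη.identDistrib i).comp (measurable_id.pow_const 2)
  have hlt {i j : ℕ} (hij : i < j) : IndepFun (η j) (η i) P :=
    indepFun_of_indep_of_measurable (hη.indep j)
      ((hη.measurable_succ i).mono (𝓖.mono hij) le_rfl)
  intro i j hij
  have : IndepFun (η i) (η j) P := by
    rcases lt_or_gt_of_ne hij with h | h
    · exact (hlt h).symm
    · exact hlt h
  exact this.comp (measurable_id.pow_const 2) (measurable_id.pow_const 2)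

lemma measurable_arProcess (hη : IsInnovation P 𝓖 η) (φ : ℝ) (i : ℕ) :
    Measurable[𝓖 i] (arProcess φ η i) := by
  induction i with
  | zero => exact measurable_const
  | succ i ih =>
    exact ((ih.mono (𝓖.mono (Nat.le_succ i)) le_rfl).const_smul φ).add (hη.measurable_succ i)

lemma memLp_arProcess (hη : IsInnovation P 𝓖 η) (φ : ℝ) (i : ℕ) :
    MemLp (arProcess φ η i) 2 P := by
  induction i with
  | zero => exact MemLp.zero
  | succ i ih => exact (ih.const_smul φ).add (hη.memLp i)

/-- The averages of innovations weighted by a past, square integrable sequence vanish: the summands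
are orthogonal. -/
lemma ae_tendsto_average_mul (hη : IsInnovation P 𝓖 η) {B : ℕ → Ω → ℝ} {C : ℝ}
    (hB : ∀ i, Measurable[𝓖 i] (B i)) (hB2 : ∀ i, MemLp (B i) 2 P)
    (hC : ∀ i, ∫ ω, B i ω ^ 2 ∂P ≤ C) (h : ℕ) :
    ∀ᵐ ω ∂P, Tendsto (fun n : ℕ => (∑ i ∈ Finset.range n, η (i + h) ω * B i ω) / n) atTop
      (𝓝 0) := by
  have hBm (i : ℕ) : Measurable[𝓖 (i + h)] (B i) :=
    (hB i).mono (𝓖.mono (Nat.le_add_right i h)) le_rfl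
  have hind (i : ℕ) : IndepFun (fun ω => η (i + h) ω ^ 2) (fun ω => B i ω ^ 2) P :=
    (indepFun_of_indep_of_measurable (hη.indep (i + h)) (hBm i)).comp
      (measurable_id.pow_const 2) (measurable_id.pow_const 2)
  have hZ (i : ℕ) : MemLp (fun ω => η (i + h) ω * B i ω) 2 P := by
    refine (memLp_two_iff_integrable_sq ((hη.memLp _).1.mul (hB2 i).1)).2 ?_
    have := (hind i).integrable_mul (hη.memLp (i + h)).integrable_sq (hB2 i).integrable_sq
    refine this.congr (ae_of_all _ fun ω => ?_)
    simp [mul_pow]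
  refine ae_tendsto_average_of_orthogonal (C := (∫ ω, η 0 ω ^ 2 ∂P) * C) hZ ?_ ?_
  · intro i j hij
    have hm : Measurable[𝓖 (j + h)] (fun ω => η (i + h) ω * B i ω * B j ω) :=
      (((hη.measurable_succ (i + h)).mono (𝓖.mono (by omega)) le_rfl).mul
        ((hBm i).mono (𝓖.mono (by omega)) le_rfl)).mul (hBm j)
    rw [← hη.integral_mul_eq_zero hm]
    refine integral_congr_ae (ae_of_all _ fun ω => ?_)
    simp only
    ring
  · intro i
    simp only [mul_pow]
    rw [(hind i).integral_fun_mul_eq_mul_integral (hη.memLp _).integrable_sq.1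
      (hB2 i).integrable_sq.1, hη.integral_sq_eq]
    exact mul_le_mul_of_nonneg_left (hC i) (integral_nonneg fun ω => sq_nonneg _)

lemma integral_sq_arProcess_le (hη : IsInnovation P 𝓖 η) {φ : ℝ} (hφ0 : 0 ≤ φ) (hφ1 : φ < 1)
    (i : ℕ) : ∫ ω, arProcess φ η i ω ^ 2 ∂P ≤ (∫ ω, η 0 ω ^ 2 ∂P) / (1 - φ ^ 2) := by
  have hφ : 0 < 1 - φ ^ 2 := by nlinarith
  induction i with
  | zero =>
    have : 0 ≤ ∫ ω, η 0 ω ^ 2 ∂P := integral_nonneg fun ω => sq_nonneg _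
    simpa [arProcess] using div_nonneg this hφ.le
  | succ i ih =>
    have i1 : Integrable (fun ω => φ ^ 2 * arProcess φ η i ω ^ 2) P :=
      (hη.memLp_arProcess φ i).integrable_sq.const_mul _
    have i2 : Integrable (fun ω => 2 * φ * (η i ω * arProcess φ η i ω)) P :=
      ((hη.memLp i).integrable_mul (hη.memLp_arProcess φ i)).const_mul _
    have i12 : Integrable (fun ω => φ ^ 2 * arProcess φ η i ω ^ 2 +
      2 * φ * (η i ω * arProcess φ η i ω)) P := i1.add i2
    have e (ω : Ω) : arProcess φ η (i + 1) ω ^ 2 = φ ^ 2 * arProcess φ η i ω ^ 2 +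
        2 * φ * (η i ω * arProcess φ η i ω) + η i ω ^ 2 := by
      simp only [arProcess, Pi.add_apply, Pi.smul_apply, smul_eq_mul]
      ring
    simp only [e]
    rw [integral_add i12 (hη.memLp i).integrable_sq, integral_add i1 i2, integral_const_mul,
      integral_const_mul, hη.integral_mul_eq_zero (hη.measurable_arProcess φ i), hη.integral_sq_eq]
    rw [le_div_iff₀ hφ] at ih ⊢
    nlinarith

variable [IsProbabilityMeasure P]

/-- The sample autocorrelations of an autoregressive process are strongly consistent, whatever its
initial value: the effect of the latter decays geometrically. -/
theorem ae_tendsto_sampleAutocorr (hη : IsInnovation P 𝓖 η) {φ : ℝ} (hφ0 : 0 ≤ φ) (hφ1 : φ < 1)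
    (hσ : 0 < ∫ ω, η 0 ω ^ 2 ∂P) {y : ℕ → Ω → ℝ} {c : ℝ}
    (hy : ∀ᵐ ω ∂P, ∀ i, y (i + 2) ω - c = φ * (y (i + 1) ω - c) + η i ω) :
    ∀ᵐ ω ∂P, ∀ h : ℕ,
      Tendsto (fun n => sampleAutocorr (fun i => y i ω) n h) atTop (𝓝 (φ ^ h)) := by
  have hX := ae_all_iff.2 fun h => hη.ae_tendsto_average_mul (hη.measurable_arProcess φ)
    (hη.memLp_arProcess φ) (hη.integral_sq_arProcess_le hφ0 hφ1) h
  have hgeo := ae_all_iff.2 fun h => hη.ae_tendsto_average_mul (B := fun i _ => φ ^ i) (C := 1)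
    (fun i => measurable_const) (fun i => memLp_const _)
    (fun i => by simpa [abs_of_nonneg hφ0] using pow_le_one₀ (n := i) hφ0 hφ1.le) h
  have hone := hη.ae_tendsto_average_mul (B := fun _ _ => 1) (C := 1)
    (fun i => measurable_const) (fun i => memLp_const _) (fun i => by simp) 0
  filter_upwards [hX, hgeo, hone, hη.ae_tendsto_average_sq, hy] with ω h1 h2 h3 h4 h5 h
  have hdec (i : ℕ) : y (i + 1) ω - c = arProcess φ η i ω + (y 1 ω - c) * φ ^ i := by
    induction i with
    | zero => simp [arProcess]
    | succ i ih =>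
      rw [h5 i, ih]
      simp only [arProcess, Pi.add_apply, Pi.smul_apply, smul_eq_mul]
      ring
  refine tendsto_sampleAutocorr_of_ar (y := fun i => y i ω) (c := c)
    (W := fun i => y (i + 1) ω - c) (η := fun i => η i ω) (fun i => by ring) hφ0 hφ1 hσ h5
    (by simpa using h3) h4 (fun h => ?_) h
  have h6 := (h1 h).add ((h2 h).const_mul (y 1 ω - c))
  rw [mul_zero, add_zero] at h6
  refine h6.congr fun n => ?_
  rw [← mul_div_assoc, ← add_div, Finset.mul_sum, ← Finset.sum_add_distrib]
  congr 1
  refine Finset.sum_congr rfl fun i _ => ?_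
  rw [hdec i]
  ring

end IsInnovation

end AutoregressiveProcess

/-! ### Second moments of a Lévy process -/

section LevyMoments

variable {Ω : Type*} {mΩ : MeasurableSpace Ω} {P : Measure Ω}

/-- If the sum of two independent random variables is square integrable, so is each of them: by
Fubini, the sum of one of them and some constant is. -/
lemma memLp_two_left_of_add [IsProbabilityMeasure P] {X Y : Ω → ℝ} (hX : Measurable X)
    (hY : Measurable Y) (h : IndepFun Y X P) (hXY : MemLp (fun ω => X ω + Y ω) 2 P) :
    MemLp X 2 P := by
  have hprod := (indepFun_iff_map_prod_eq_prod_map_map hX.aemeasurable hY.aemeasurable).1 h.symm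
  have hi : Integrable (fun p : ℝ × ℝ => (p.1 + p.2) ^ 2) ((P.map X).prod (P.map Y)) := by
    rw [← hprod, integrable_map_measure (by fun_prop) (hX.prodMk hY).aemeasurable]
    exact hXY.integrable_sq
  have := Measure.isProbabilityMeasure_map (μ := P) hX.aemeasurable
  have := Measure.isProbabilityMeasure_map (μ := P) hY.aemeasurable
  obtain ⟨y, hy⟩ := hi.prod_left_ae.exists
  have hy' : Integrable (fun ω => (X ω + y) ^ 2) P :=
    (integrable_map_measure (g := fun x => (x + y) ^ 2) (by fun_prop) hX.aemeasurable).1 hy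
  have h2 : MemLp (fun ω => X ω + y) 2 P :=
    (memLp_two_iff_integrable_sq (by fun_prop)).2 hy'
  refine (h2.sub (memLp_const y)).ae_eq (ae_of_all _ fun ω => ?_)
  simp

namespace IsLevyProcess

variable {𝓕 : Filtration ℝ≥0 mΩ} {L : ℝ≥0 → Ω → ℝ}

lemma measurable (hL : IsLevyProcess P 𝓕 L) (t : ℝ≥0) : Measurable (L t) :=
  (hL.adapted t).mono (𝓕.le t) le_rfl

lemma measurable_of_le (hL : IsLevyProcess P 𝓕 L) {s t : ℝ≥0} (hst : s ≤ t) :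
    Measurable[𝓕 t] (L s) :=
  (hL.adapted s).mono (𝓕.mono hst) le_rfl

lemma indepFun_increment (hL : IsLevyProcess P 𝓕 L) {β : Type*} [MeasurableSpace β] {s t : ℝ≥0}
    (hst : s ≤ t) {f : Ω → β} (hf : Measurable[𝓕 s] f) :
    IndepFun (fun ω => L t ω - L s ω) f P :=
  indepFun_of_indep_of_measurable (hL.indep_increment s t hst) hf

/-- Square integrability at time `1` propagates to later times by adding increments, and to earlier
times since the increments are independent. -/
lemma memLp_two [IsProbabilityMeasure P] (hL : IsLevyProcess P 𝓕 L) (h1 : MemLp (L 1) 2 P)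
    (t : ℝ≥0) : MemLp (L t) 2 P := by
  have hnat (n : ℕ) : MemLp (L ((n : ℝ≥0) + 1)) 2 P := by
    induction n with
    | zero => simpa using h1
    | succ n ih =>
      have hle : (n : ℝ≥0) + 1 ≤ (n + 1 : ℕ) + 1 := by push_cast; exact le_self_add
      have hst := hL.stationary_increment _ _ hle
      rw [show ((n + 1 : ℕ) : ℝ≥0) + 1 - (n + 1) = 1 by push_cast; exact add_tsub_cancel_left _ _]
        at hst
      refine (ih.add (hst.memLp_iff.2 h1)).ae_eq (ae_of_all _ fun ω => ?_)
      simp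
  obtain ⟨n, hn⟩ := exists_nat_ge t
  have hle : t ≤ (n : ℝ≥0) + 1 := hn.trans le_self_add
  refine memLp_two_left_of_add (hL.measurable t)
    ((hL.measurable _).sub (hL.measurable t)) (hL.indepFun_increment hle (hL.adapted t)) ?_
  refine (hnat n).ae_eq (ae_of_all _ fun ω => ?_)
  simp

section Grid

variable {τ : ℕ → ℝ≥0} {δ : ℝ≥0}

lemma identDistrib_grid_increment (hL : IsLevyProcess P 𝓕 L) (hτ : ∀ k, τ (k + 1) = τ k + δ)
    (k : ℕ) : IdentDistrib (fun ω => L (τ (k + 1)) ω - L (τ k) ω) (L δ) P P := by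
  have := hL.stationary_increment (τ k) (τ (k + 1)) (by rw [hτ]; exact le_self_add)
  rwa [hτ k, add_tsub_cancel_left, ← hτ k] at this

lemma memLp_weighted_sum (hL : IsLevyProcess P 𝓕 L) (hτ : ∀ k, τ (k + 1) = τ k + δ)
    (h2 : MemLp (L δ) 2 P) (a : ℕ → ℝ) (n : ℕ) :
    MemLp (fun ω => ∑ k ∈ Finset.range n, a k * (L (τ (k + 1)) ω - L (τ k) ω)) 2 P :=
  memLp_finsetSum _ fun k _ => ((hL.identDistrib_grid_increment hτ k).memLp_iff.2 h2).const_mul _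

lemma integral_weighted_sum [IsProbabilityMeasure P] (hL : IsLevyProcess P 𝓕 L)
    (hτ : ∀ k, τ (k + 1) = τ k + δ)
    (h2 : MemLp (L δ) 2 P) (a : ℕ → ℝ) (n : ℕ) :
    ∫ ω, ∑ k ∈ Finset.range n, a k * (L (τ (k + 1)) ω - L (τ k) ω) ∂P =
      (∑ k ∈ Finset.range n, a k) * ∫ ω, L δ ω ∂P := by
  have hi (k : ℕ) : MemLp (fun ω => L (τ (k + 1)) ω - L (τ k) ω) 2 P :=
    (hL.identDistrib_grid_increment hτ k).memLp_iff.2 h2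
  rw [integral_finsetSum _ fun k _ => ((hi k).integrable one_le_two).const_mul _, Finset.sum_mul]
  refine Finset.sum_congr rfl fun k _ => ?_
  rw [integral_const_mul, (hL.identDistrib_grid_increment hτ k).integral_eq]

lemma variance_weighted_sum (hL : IsLevyProcess P 𝓕 L) (hτ : ∀ k, τ (k + 1) = τ k + δ)
    (h2 : MemLp (L δ) 2 P) (a : ℕ → ℝ) (n : ℕ) :
    Var[fun ω => ∑ k ∈ Finset.range n, a k * (L (τ (k + 1)) ω - L (τ k) ω); P] =
      (∑ k ∈ Finset.range n, a k ^ 2) * Var[L δ; P] := by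
  have hmono : Monotone τ := monotone_nat_of_le_succ fun k => by rw [hτ]; exact le_self_add
  have hi (k : ℕ) : MemLp (fun ω => a k * (L (τ (k + 1)) ω - L (τ k) ω)) 2 P :=
    ((hL.identDistrib_grid_increment hτ k).memLp_iff.2 h2).const_mul _
  have hlt {i j : ℕ} (hij : i < j) : IndepFun (fun ω => a j * (L (τ (j + 1)) ω - L (τ j) ω))
      (fun ω => a i * (L (τ (i + 1)) ω - L (τ i) ω)) P := by
    refine (hL.indepFun_increment (hmono (Nat.le_succ j))
      (f := fun ω => L (τ (i + 1)) ω - L (τ i) ω) ?_).comp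
      (measurable_const_mul (a j)) (measurable_const_mul (a i))
    exact (hL.measurable_of_le (hmono hij)).sub (hL.measurable_of_le (hmono hij.le))
  have := IndepFun.variance_sum (μ := P) (s := Finset.range n)
    (X := fun k ω => a k * (L (τ (k + 1)) ω - L (τ k) ω)) (fun k _ => hi k)
    (fun i _ j _ hij => by
      rcases lt_or_gt_of_ne hij with h | h
      · exact (hlt h).symm
      · exact hlt h)
  rw [show (fun ω => ∑ k ∈ Finset.range n, a k * (L (τ (k + 1)) ω - L (τ k) ω)) =
    ∑ k ∈ Finset.range n, fun ω => a k * (L (τ (k + 1)) ω - L (τ k) ω) by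
      ext ω; simp [Finset.sum_apply], this, Finset.sum_mul]
  refine Finset.sum_congr rfl fun k _ => ?_
  rw [variance_const_mul, (hL.identDistrib_grid_increment hτ k).variance_eq]

/-- The characteristic function of a weighted sum of increments, conditionally on an event of the
past. -/
lemma setIntegral_exp_weighted_sum (hL : IsLevyProcess P 𝓕 L) (hτ : ∀ k, τ (k + 1) = τ k + δ)
    {A : Set Ω} (hA : MeasurableSet[𝓕 (τ 0)] A) (a : ℕ → ℝ) (u : ℝ) (n : ℕ) :
    ∫ ω in A, Complex.exp (u * (∑ k ∈ Finset.range n, a k * (L (τ (k + 1)) ω - L (τ k) ω) : ℝ) *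
        Complex.I) ∂P =
      P.real A * ∏ k ∈ Finset.range n, charFun (P.map (L δ)) (u * a k) := by
  have hmono : Monotone τ := monotone_nat_of_le_succ fun k => by rw [hτ]; exact le_self_add
  rw [← integral_indicator (𝓕.le _ _ hA)]
  induction n with
  | zero => simp [integral_indicator (𝓕.le _ _ hA)]
  | succ n ih =>
    have hmeas : Measurable[𝓕 (τ n)] (A.indicator fun ω => Complex.exp (u *
        (∑ k ∈ Finset.range n, a k * (L (τ (k + 1)) ω - L (τ k) ω) : ℝ) * Complex.I)) := by
      refine Measurable.indicator ?_ (𝓕.mono (hmono (Nat.zero_le n)) _ hA)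
      have hS : Measurable[𝓕 (τ n)]
          (fun ω => ∑ k ∈ Finset.range n, a k * (L (τ (k + 1)) ω - L (τ k) ω)) :=
        Finset.measurable_fun_sum _ fun k hk => Measurable.const_mul
          ((hL.measurable_of_le (hmono (Finset.mem_range.1 hk))).sub
            (hL.measurable_of_le (hmono (Finset.mem_range.1 hk).le))) _
      exact (show Measurable fun x : ℝ => Complex.exp (u * (x : ℂ) * Complex.I) by fun_prop).comp hS
    have hinc : Measurable fun ω => L (τ (n + 1)) ω - L (τ n) ω :=
      (hL.measurable _).sub (hL.measurable _)
    have hexp : Measurable fun x : ℝ => Complex.exp ((u * a n : ℝ) * x * Complex.I) := by fun_prop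
    have hind := ((hL.indepFun_increment (hmono (Nat.le_succ n)) hmeas).comp
      hexp measurable_id).symm
    have hprod := hind.integral_fun_mul_eq_mul_integral
      (hmeas.mono (𝓕.le _) le_rfl).aestronglyMeasurable (hexp.comp hinc).aestronglyMeasurable
    have hlaw : ∫ ω, Complex.exp ((u * a n : ℝ) * (L (τ (n + 1)) ω - L (τ n) ω : ℝ) * Complex.I) ∂P
        = charFun (P.map (L δ)) (u * a n) := by
      rw [← (hL.identDistrib_grid_increment hτ n).map_eq, charFun_apply_real,
        integral_map hinc.aemeasurable hexp.aestronglyMeasurable]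
    rw [Finset.prod_range_succ, ← mul_assoc, ← ih, ← hlaw]
    refine Eq.trans (integral_congr_ae (ae_of_all _ fun ω => ?_)) hprod
    by_cases hω : ω ∈ A
    · simp only [Set.indicator_of_mem hω, Function.comp_apply, id, Finset.sum_range_succ]
      rw [← Complex.exp_add]
      congr 1
      push_cast
      ring
    · simp [Set.indicator_of_notMem hω]

end Grid

lemma variance_pos [IsProbabilityMeasure P] (hL : IsLevyProcess P 𝓕 L) (h2 : MemLp (L 1) 2 P)
    (hσ : 0 < Var[L 1; P]) {t : ℝ≥0} (ht : 0 < t) : 0 < Var[L t; P] := by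
  refine (variance_nonneg _ _).lt_of_ne' fun h0 => ?_
  obtain ⟨n, hn⟩ := exists_nat_ge (1 / t)
  have hn1 : 1 ≤ t * n := by rwa [div_le_iff₀ ht, mul_comm] at hn
  have hτ (k : ℕ) : t * ((k + 1 : ℕ) : ℝ≥0) = t * k + t := by push_cast; ring
  have h := hL.variance_weighted_sum (τ := fun k => t * k) hτ (hL.memLp_two h2 t) (fun _ => 1) n
  simp only [one_mul] at h
  have htel (ω : Ω) : ∑ k ∈ Finset.range n, (L (t * ((k + 1 : ℕ) : ℝ≥0)) ω - L (t * k) ω) =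
      L (t * n) ω - L 0 ω := by
    rw [Finset.sum_range_sub (fun k : ℕ => L (t * k) ω)]
    simp
  simp only [htel] at h
  rw [(hL.stationary_increment 0 (t * n) zero_le).variance_eq, tsub_zero, h0, mul_zero] at h
  have hsplit := (hL.indepFun_increment hn1 (hL.adapted 1)).variance_fun_add
    ((hL.memLp_two h2 _).sub h2) h2
  have hcongr : (fun ω => (L (t * n) - L 1) ω + L 1 ω) = L (t * n) := by ext ω; simp
  rw [hcongr] at hsplit
  linarith [variance_nonneg (L (t * n) - L 1) P]

end IsLevyProcess
end LevyMoments

/-! ### Limits in probability -/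

section Limits

/-- A random variable whose characteristic function is not affected by conditioning on the events
of a σ-algebra is independent of it. -/
lemma indep_of_setIntegral_exp_eq {Ω : Type*} {m mΩ : MeasurableSpace Ω} {P : Measure Ω}
    [IsProbabilityMeasure P] {ξ : Ω → ℝ} (hξ : Measurable ξ)
    (h : ∀ A, MeasurableSet[m] A → ∀ u : ℝ, ∫ ω in A, Complex.exp (u * ξ ω * Complex.I) ∂P =
      P.real A * charFun (P.map ξ) u) :
    Indep (MeasurableSpace.comap ξ inferInstance) m P := by
  rw [Indep_iff]
  rintro _ A ⟨B, hB, rfl⟩ hA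
  have hmap : (P.restrict A).map ξ = P A • P.map ξ := by
    have : IsFiniteMeasure (P A • P.map ξ) := (P.map ξ).smul_finite (measure_ne_top P A)
    refine Measure.ext_of_charFun (funext fun u => ?_)
    have he : Measurable fun x : ℝ => Complex.exp (u * (x : ℂ) * Complex.I) := by fun_prop
    have h1 := h A hA u
    rw [charFun_apply_real] at h1 ⊢
    rw [charFun_apply_real, integral_smul_measure,
      integral_map hξ.aemeasurable he.aestronglyMeasurable, h1]
    simp [Measure.real]
  have h2 := congrArg (fun μ => μ B) hmap
  simp only [Measure.smul_apply, smul_eq_mul] at h2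
  rw [Measure.map_apply hξ hB, Measure.map_apply hξ hB,
    Measure.restrict_apply (hξ hB)] at h2
  rw [h2, mul_comm]

variable {Ω : Type*} {mΩ : MeasurableSpace Ω} {P : Measure Ω}

lemma tendsto_setIntegral_exp_of_tendstoInMeasure [IsFiniteMeasure P] {V : ℕ → Ω → ℝ} {ξ : Ω → ℝ}
    (hV : ∀ N, Measurable (V N)) (h : TendstoInMeasure P V atTop ξ) (A : Set Ω) (u : ℝ) :
    Tendsto (fun N => ∫ ω in A, Complex.exp (u * V N ω * Complex.I) ∂P) atTop
      (𝓝 (∫ ω in A, Complex.exp (u * ξ ω * Complex.I) ∂P)) := by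
  refine tendsto_of_subseq_tendsto fun ns hns => ?_
  obtain ⟨ms, -, hms⟩ := (h.comp hns).exists_seq_tendsto_ae
  refine ⟨ms, tendsto_integral_of_dominated_convergence (fun _ => (1 : ℝ)) (fun N => ?_)
    (integrable_const _) (fun N => ae_of_all _ fun ω => ?_) ?_⟩
  · have := hV (ns (ms N))
    exact Measurable.aestronglyMeasurable (by fun_prop)
  · rw [← Complex.ofReal_mul, Complex.norm_exp_ofReal_mul_I]
  · refine ae_restrict_of_ae ?_
    filter_upwards [hms] with ω hω
    have hc : Continuous fun x : ℝ => Complex.exp (u * (x : ℂ) * Complex.I) := by fun_prop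
    exact (hc.tendsto _).comp hω

/-- A limit in probability of random variables with bounded means is square integrable, with
variance at most the bound on the variances of the sequence. -/
lemma variance_le_of_tendstoInMeasure [IsProbabilityMeasure P] {V : ℕ → Ω → ℝ} {ξ : Ω → ℝ}
    {B C : ℝ} (hV : ∀ N, MemLp (V N) 2 P) (h : TendstoInMeasure P V atTop ξ)
    (hξ : AEStronglyMeasurable ξ P) (hB : ∀ N, |∫ ω, V N ω ∂P| ≤ B) (hC : ∀ N, Var[V N; P] ≤ C) :
    MemLp ξ 2 P ∧ Var[ξ; P] ≤ C := by
  have hC0 : 0 ≤ C := (variance_nonneg _ _).trans (hC 0)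
  obtain ⟨ns, hns, hae⟩ := h.exists_seq_tendsto_ae
  obtain ⟨m, -, ms, hms, hm⟩ := tendsto_subseq_of_bounded (Metric.isBounded_Icc (-B) B)
    (x := fun k => ∫ ω, V (ns k) ω ∂P) fun k => abs_le.1 (hB (ns k))
  have hint : ∫⁻ ω, ENNReal.ofReal ((ξ ω - m) ^ 2) ∂P ≤ ENNReal.ofReal C := by
    let g : ℕ → Ω → ℝ≥0∞ := fun k ω =>
      ENNReal.ofReal ((V (ns (ms k)) ω - ∫ ω', V (ns (ms k)) ω' ∂P) ^ 2)
    have hg (k : ℕ) : ∫⁻ ω, g k ω ∂P ≤ ENNReal.ofReal C := by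
      rw [← evariance_eq_lintegral_ofReal, ← ofReal_variance (hV _)]
      exact ENNReal.ofReal_le_ofReal (hC _)
    calc ∫⁻ ω, ENNReal.ofReal ((ξ ω - m) ^ 2) ∂P
        = ∫⁻ ω, liminf (fun k => g k ω) atTop ∂P := by
          refine lintegral_congr_ae ?_
          filter_upwards [hae] with ω hω
          have h1 := ((hω.comp hms.tendsto_atTop).sub hm).pow 2
          exact ((ENNReal.continuous_ofReal.tendsto _).comp h1).liminf_eq.symm
      _ ≤ liminf (fun k => ∫⁻ ω, g k ω ∂P) atTop :=
          lintegral_liminf_le' fun k =>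
            (((hV _).1.aemeasurable.sub_const _).pow_const 2).ennreal_ofReal
      _ ≤ ENNReal.ofReal C := liminf_le_of_frequently_le' (Frequently.of_forall hg)
  have hmeas : AEStronglyMeasurable (fun ω => ξ ω - m) P := hξ.sub aestronglyMeasurable_const
  have hL : MemLp (fun ω => ξ ω - m) 2 P := by
    rw [memLp_two_iff_integrable_sq hmeas]
    refine ⟨hmeas.pow 2, ?_⟩
    rw [hasFiniteIntegral_iff_ofReal (ae_of_all _ fun ω => sq_nonneg _)]
    exact hint.trans_lt ENNReal.ofReal_lt_top
  constructor
  · refine (hL.add (memLp_const m)).ae_eq (ae_of_all _ fun ω => ?_)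
    simp
  · rw [← variance_sub_const hξ m]
    refine (variance_le_expectation_sq hmeas).trans ?_
    rw [← ENNReal.ofReal_le_ofReal_iff hC0]
    refine le_trans (le_of_eq ?_) hint
    rw [ofReal_integral_eq_lintegral_ofReal
      (show Integrable ((fun ω => ξ ω - m) ^ 2) P from hL.integrable_sq)
      (ae_of_all _ fun ω => by simp only [Pi.pow_apply]; positivity)]
    rfl

lemma tendstoInMeasure_const_mul_sub {V W : ℕ → Ω → ℝ} {v w : Ω → ℝ}
    (hV : TendstoInMeasure P V atTop v) (hW : TendstoInMeasure P W atTop w) {c : ℝ} (hc : 0 < c) :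
    TendstoInMeasure P (fun N ω => c * (V N ω - W N ω)) atTop (fun ω => c * (v ω - w ω)) := by
  rw [tendstoInMeasure_iff_dist] at *
  intro ε hε
  have hε' : 0 < ε / c / 2 := by positivity
  have h := (hV _ hε').add (hW _ hε')
  rw [add_zero] at h
  refine tendsto_of_tendsto_of_tendsto_of_le_of_le tendsto_const_nhds h (fun _ => zero_le)
    fun N => ?_
  refine (measure_mono fun ω hω => ?_).trans (measure_union_le _ _)
  simp only [Set.mem_ofPred_eq, Set.mem_union] at hω ⊢
  by_contra hcon
  push Not at hcon
  simp only [Real.dist_eq] at hω hcon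
  have h1 : |c * (V N ω - W N ω) - c * (v ω - w ω)| ≤ c * (|V N ω - v ω| + |W N ω - w ω|) := by
    rw [← mul_sub, abs_mul, abs_of_pos hc]
    refine mul_le_mul_of_nonneg_left ?_ hc.le
    rw [show V N ω - W N ω - (v ω - w ω) = (V N ω - v ω) - (W N ω - w ω) by ring]
    exact abs_sub _ _
  have h2 : c * (|V N ω - v ω| + |W N ω - w ω|) < c * (ε / c / 2 + ε / c / 2) :=
    mul_lt_mul_of_pos_left (add_lt_add hcon.1 hcon.2) hc
  have h3 : c * (ε / c / 2 + ε / c / 2) = ε := by field_simp; ring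
  linarith

/-- A limit in probability of random variables measurable with respect to a sub-σ-algebra has a
version measurable with respect to it. -/
lemma exists_measurable_version_of_tendstoInMeasure {m : MeasurableSpace Ω} {V : ℕ → Ω → ℝ}
    {ξ : Ω → ℝ} (hV : ∀ N, Measurable[m] (V N)) (h : TendstoInMeasure P V atTop ξ) :
    ∃ ξ' : Ω → ℝ, Measurable[m] ξ' ∧ ξ =ᵐ[P] ξ' := by
  obtain ⟨ns, -, hns⟩ := h.exists_seq_tendsto_ae
  refine ⟨fun ω => limsup (fun k => V (ns k) ω) atTop, Measurable.limsup fun k => hV (ns k), ?_⟩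
  filter_upwards [hns] with ω hω
  exact hω.limsup_eq.symm

end Limits

/-! ### The innovations of the Ornstein–Uhlenbeck process -/

section Innovations

variable {Ω : Type*} {mΩ : MeasurableSpace Ω} {P : Measure Ω}

/-- The grid `lam * k / (N + 1)`, which divides each interval `[lam * j, lam * (j + 1)]` into
`N + 1` equal parts. -/
noncomputable def uniformGrid (lam : ℝ≥0) (N k : ℕ) : ℝ≥0 := lam * k / ((N : ℝ≥0) + 1)

lemma uniformGrid_succ (lam : ℝ≥0) (N k : ℕ) :
    uniformGrid lam N (k + 1) = uniformGrid lam N k + lam / ((N : ℝ≥0) + 1) := by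
  simp only [uniformGrid]
  push_cast
  ring

lemma uniformGrid_mul (lam : ℝ≥0) (N j : ℕ) : uniformGrid lam N ((N + 1) * j) = lam * j := by
  have : (N : ℝ≥0) + 1 ≠ 0 := by positivity
  simp only [uniformGrid]
  push_cast
  field_simp

lemma uniformGrid_monotone (lam : ℝ≥0) (N : ℕ) : Monotone (uniformGrid lam N) :=
  monotone_nat_of_le_succ fun k => by rw [uniformGrid_succ]; exact le_self_add

lemma IsStochIntegral.tendstoInMeasure_leftSum {f : ℝ≥0 → ℝ} {L : ℝ≥0 → Ω → ℝ} {lam : ℝ≥0} {j : ℕ}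
    {I : Ω → ℝ} (h : IsStochIntegral P f L 0 (lam * j) I) :
    TendstoInMeasure P (fun N ω => leftSum f L ((N + 1) * j) (uniformGrid lam N) ω) atTop I := by
  rw [tendstoInMeasure_iff_dist]
  intro ε hε
  rw [ENNReal.tendsto_nhds_zero]
  intro ρ hρ
  obtain ⟨ε', hε'0, hε', hρ'⟩ : ∃ ε' : ℝ, 0 < ε' ∧ ε' ≤ ε ∧ ENNReal.ofReal ε' ≤ ρ := by
    rcases eq_or_ne ρ ∞ with rfl | hρ'
    · exact ⟨ε, hε, le_rfl, le_top⟩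
    · refine ⟨min ε ρ.toReal, lt_min hε (ENNReal.toReal_pos hρ.ne' hρ'), min_le_left _ _, ?_⟩
      exact ENNReal.ofReal_le_of_le_toReal (min_le_right _ _)
  obtain ⟨δ, hδ, H⟩ := h ε' hε'0
  obtain ⟨M, hM⟩ := exists_nat_ge (lam / δ)
  filter_upwards [eventually_ge_atTop M] with N hN
  refine (measure_mono fun ω hω => ?_).trans ((H _ (uniformGrid lam N) (uniformGrid_monotone lam N)
    (by simp [uniformGrid]) (uniformGrid_mul lam N j) fun i _ => ?_).trans hρ')
  · rw [Set.mem_ofPred_eq, Real.dist_eq] at hω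
    exact hε'.trans hω
  · rw [uniformGrid_succ, add_tsub_cancel_left, div_le_iff₀ (by positivity)]
    rw [div_le_iff₀ hδ, mul_comm] at hM
    refine hM.trans (mul_le_mul_of_nonneg_left ?_ zero_le)
    exact (Nat.cast_le.2 hN).trans le_self_add

/-- The left-point approximation of `e^{-lam (j+1)} ∫ e^s dL_s` over `[lam j, lam (j + 1)]`. -/
noncomputable def innovationSum (L : ℝ≥0 → Ω → ℝ) (lam : ℝ≥0) (j N : ℕ) (ω : Ω) : ℝ :=
  ∑ k ∈ Finset.range (N + 1), Real.exp (lam * k / (N + 1) - lam) *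
    (L (uniformGrid lam N ((N + 1) * j + (k + 1))) ω - L (uniformGrid lam N ((N + 1) * j + k)) ω)

lemma innovationSum_eq (L : ℝ≥0 → Ω → ℝ) (lam : ℝ≥0) (j N : ℕ) (ω : Ω) :
    innovationSum L lam j N ω = Real.exp (-(lam * (j + 1 : ℕ))) *
      (leftSum (fun s => Real.exp s) L ((N + 1) * (j + 1)) (uniformGrid lam N) ω -
        leftSum (fun s => Real.exp s) L ((N + 1) * j) (uniformGrid lam N) ω) := by
  rw [leftSum, leftSum, mul_add_one, Finset.sum_range_add, add_sub_cancel_left, Finset.mul_sum]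
  refine Finset.sum_congr rfl fun k _ => ?_
  rw [← mul_assoc, ← Real.exp_add]
  congr 2
  simp only [uniformGrid]
  push_cast
  field_simp
  ring

variable {L Y : ℝ≥0 → Ω → ℝ} {lam : ℝ≥0}

lemma IsOUProcess.tendstoInMeasure_innovationSum (hY : IsOUProcess P L lam Y) (j : ℕ) :
    TendstoInMeasure P (innovationSum L lam j) atTop
      (fun ω => Y (j + 1 : ℕ) ω - Real.exp (-lam) * Y j ω) := by
  obtain ⟨I, hI, hYI⟩ := hY j
  obtain ⟨J, hJ, hYJ⟩ := hY (j + 1 : ℕ)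
  have h := tendstoInMeasure_const_mul_sub hJ.tendstoInMeasure_leftSum hI.tendstoInMeasure_leftSum
    (Real.exp_pos (-(lam * (j + 1 : ℕ) : ℝ)))
  refine h.congr (fun N => ae_of_all _ fun ω => ?_) ?_
  · exact (innovationSum_eq L lam j N ω).symm
  · filter_upwards [hYI, hYJ] with ω h1 h2
    rw [h1, h2]
    have e : Real.exp (-(lam * (j + 1 : ℕ) : ℝ)) = Real.exp (-lam) * Real.exp (-(lam * j)) := by
      rw [← Real.exp_add]
      congr 1
      push_cast
      ring
    simp only [NNReal.coe_natCast, e]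
    ring

namespace IsLevyProcess

variable {𝓕 : Filtration ℝ≥0 mΩ}

lemma measurable_innovationSum (hL : IsLevyProcess P 𝓕 L) (j N : ℕ) :
    Measurable[𝓕 (lam * (j + 1 : ℕ))] (innovationSum L lam j N) := by
  refine Finset.measurable_fun_sum _ fun k hk => Measurable.const_mul ?_ _
  have hle (i : ℕ) (hi : i ≤ N + 1) :
      uniformGrid lam N ((N + 1) * j + i) ≤ lam * (j + 1 : ℕ) := by
    rw [← uniformGrid_mul lam N (j + 1), mul_add_one]
    exact uniformGrid_monotone lam N (by omega)
  have := Finset.mem_range.1 hk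
  exact (hL.measurable_of_le (hle _ (by omega))).sub (hL.measurable_of_le (hle _ (by omega)))

lemma setIntegral_exp_innovationSum (hL : IsLevyProcess P 𝓕 L) (j N : ℕ) {A : Set Ω}
    (hA : MeasurableSet[𝓕 (lam * j)] A) (u : ℝ) :
    ∫ ω in A, Complex.exp (u * innovationSum L lam j N ω * Complex.I) ∂P =
      P.real A * ∏ k ∈ Finset.range (N + 1), charFun (P.map (L (lam / ((N : ℝ≥0) + 1))))
        (u * Real.exp (lam * k / (N + 1) - lam)) := by
  refine hL.setIntegral_exp_weighted_sum
    (τ := fun k => uniformGrid lam N ((N + 1) * j + k))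
    (fun k => uniformGrid_succ lam N _) ?_
    (fun k : ℕ => Real.exp (lam * k / (N + 1) - lam)) u (N + 1)
  rwa [add_zero, uniformGrid_mul]

variable [IsProbabilityMeasure P]

lemma tendsto_prod_charFun (hL : IsLevyProcess P 𝓕 L) (hY : IsOUProcess P L lam Y)
    (hYm : ∀ t, Measurable (Y t)) (j : ℕ) (u : ℝ) :
    Tendsto (fun N : ℕ => ∏ k ∈ Finset.range (N + 1),
      charFun (P.map (L (lam / ((N : ℝ≥0) + 1)))) (u * Real.exp (lam * k / (N + 1) - lam))) atTop
      (𝓝 (charFun (P.map fun ω => Y (j + 1 : ℕ) ω - Real.exp (-lam) * Y j ω) u)) := by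
  have h := tendsto_setIntegral_exp_of_tendstoInMeasure
    (fun N => (hL.measurable_innovationSum j N).mono (𝓕.le _) le_rfl)
    (hY.tendstoInMeasure_innovationSum j) Set.univ u
  simp only [hL.setIntegral_exp_innovationSum j _ MeasurableSet.univ] at h
  have he : Measurable fun x : ℝ => Complex.exp (u * (x : ℂ) * Complex.I) := by fun_prop
  rw [charFun_apply_real, integral_map (by fun_prop) he.aestronglyMeasurable]
  simpa using h

/-- The innovation over `[lam j, lam (j + 1)]` is independent of the past. -/
lemma indep_innovation (hL : IsLevyProcess P 𝓕 L) (hY : IsOUProcess P L lam Y)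
    (hYm : ∀ t, Measurable (Y t)) (j : ℕ) :
    Indep (MeasurableSpace.comap (fun ω => Y (j + 1 : ℕ) ω - Real.exp (-lam) * Y j ω) inferInstance)
      (𝓕 (lam * j)) P := by
  refine indep_of_setIntegral_exp_eq (by fun_prop) fun A hA u => ?_
  have h := tendsto_setIntegral_exp_of_tendstoInMeasure
    (fun N => (hL.measurable_innovationSum j N).mono (𝓕.le _) le_rfl)
    (hY.tendstoInMeasure_innovationSum j) A u
  simp only [hL.setIntegral_exp_innovationSum j _ hA] at h
  exact tendsto_nhds_unique h ((hL.tendsto_prod_charFun hY hYm j u).const_mul _)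

lemma identDistrib_innovation (hL : IsLevyProcess P 𝓕 L) (hY : IsOUProcess P L lam Y)
    (hYm : ∀ t, Measurable (Y t)) (i j : ℕ) :
    IdentDistrib (fun ω => Y (i + 1 : ℕ) ω - Real.exp (-lam) * Y i ω)
      (fun ω => Y (j + 1 : ℕ) ω - Real.exp (-lam) * Y j ω) P P := by
  refine ⟨by fun_prop, by fun_prop, ?_⟩
  have hm (k : ℕ) : IsProbabilityMeasure
      (P.map fun ω => Y (k + 1 : ℕ) ω - Real.exp (-lam) * Y k ω) :=
    Measure.isProbabilityMeasure_map (by fun_prop)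
  exact Measure.ext_of_charFun (funext fun u =>
    tendsto_nhds_unique (hL.tendsto_prod_charFun hY hYm i u) (hL.tendsto_prod_charFun hY hYm j u))

/-- The innovations are square integrable and not degenerate. All the weights `e^{s - lam}` lie
between `φ = e^{-lam}` and `1`, so replacing them by `a = (1 + φ) / 2` changes the innovation by a
random variable of variance at most `((1 - φ) / 2)² Var L_lam`, which is less than the variance
`a² Var L_lam` of the result. -/
lemma memLp_innovation_and_variance_pos (hL : IsLevyProcess P 𝓕 L) (hY : IsOUProcess P L lam Y)
    (hYm : ∀ t, Measurable (Y t)) (h2 : MemLp (L 1) 2 P) (hσ : 0 < Var[L 1; P]) (hlam : 0 < lam)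
    (j : ℕ) :
    MemLp (fun ω => Y (j + 1 : ℕ) ω - Real.exp (-lam) * Y j ω) 2 P ∧
      0 < Var[fun ω => Y (j + 1 : ℕ) ω - Real.exp (-lam) * Y j ω; P] := by
  set ξ : Ω → ℝ := fun ω => Y (j + 1 : ℕ) ω - Real.exp (-lam) * Y j ω with hξdef
  have hξm : Measurable ξ := by fun_prop
  have hφ0 : 0 < Real.exp (-(lam : ℝ)) := Real.exp_pos _
  have hφ1 : Real.exp (-(lam : ℝ)) ≤ 1 := Real.exp_le_one_iff.2 (by simp)
  set φ : ℝ := Real.exp (-lam) with hφ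
  let D : Ω → ℝ := fun ω => L (lam * (j + 1 : ℕ)) ω - L (lam * j) ω
  have hDid : IdentDistrib D (L lam) P P := by
    have := hL.stationary_increment (lam * j) (lam * (j + 1 : ℕ)) (by push_cast; gcongr; simp)
    rwa [show lam * ((j + 1 : ℕ) : ℝ≥0) - lam * j = lam by
      push_cast; rw [mul_add_one, add_tsub_cancel_left]] at this
  have hD2 : MemLp D 2 P := hDid.memLp_iff.2 (hL.memLp_two h2 lam)
  have hv : 0 < Var[L lam; P] := hL.variance_pos h2 hσ hlam
  -- `D` is the sum of the increments over the grid
  have hτ (N k : ℕ) : uniformGrid lam N ((N + 1) * j + (k + 1)) =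
      uniformGrid lam N ((N + 1) * j + k) + lam / ((N : ℝ≥0) + 1) := uniformGrid_succ lam N _
  have hDsum (N : ℕ) (ω : Ω) : D ω = ∑ k ∈ Finset.range (N + 1), 1 *
      (L (uniformGrid lam N ((N + 1) * j + (k + 1))) ω -
        L (uniformGrid lam N ((N + 1) * j + k)) ω) := by
    simp only [one_mul]
    rw [Finset.sum_range_sub (fun k => L (uniformGrid lam N ((N + 1) * j + k)) ω), ← mul_add_one,
      uniformGrid_mul, add_zero, uniformGrid_mul]
  have hstep (N : ℕ) : MemLp (L (lam / ((N : ℝ≥0) + 1))) 2 P := hL.memLp_two h2 _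
  have hvar (N : ℕ) : ((N : ℝ) + 1) * Var[L (lam / ((N : ℝ≥0) + 1)); P] = Var[L lam; P] := by
    have := hL.variance_weighted_sum (τ := fun k => uniformGrid lam N ((N + 1) * j + k)) (hτ N)
      (hstep N) (fun _ => 1) (N + 1)
    rw [← hDid.variance_eq, show D = _ from funext (hDsum N), this]
    simp
  have hmean (N : ℕ) : ((N : ℝ) + 1) * ∫ ω, L (lam / ((N : ℝ≥0) + 1)) ω ∂P = ∫ ω, L lam ω ∂P := by
    have := hL.integral_weighted_sum (τ := fun k => uniformGrid lam N ((N + 1) * j + k)) (hτ N)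
      (hstep N) (fun _ => 1) (N + 1)
    rw [← hDid.integral_eq, show D = _ from funext (hDsum N), this]
    simp
  let a : ℝ := (1 + φ) / 2
  let b : ℝ := (1 - φ) / 2
  have hw (N k : ℕ) (hk : k ∈ Finset.range (N + 1)) :
      |Real.exp (lam * k / (N + 1) - lam) - a| ≤ b := by
    have hk' : (k : ℝ) ≤ N + 1 := by exact_mod_cast (Finset.mem_range.1 hk).le
    have h1 : Real.exp (lam * k / (N + 1) - lam) ≤ 1 := by
      rw [Real.exp_le_one_iff, sub_nonpos, div_le_iff₀ (by positivity)]
      exact mul_le_mul_of_nonneg_left hk' lam.2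
    have h0 : φ ≤ Real.exp (lam * k / (N + 1) - lam) := by
      rw [hφ, Real.exp_le_exp]
      have : (0 : ℝ) ≤ lam * k / (N + 1) := by positivity
      linarith
    rw [abs_le]
    constructor <;> simp only [a, b] <;> linarith
  have hVeq (N : ℕ) : (fun ω => innovationSum L lam j N ω - a * D ω) = fun ω =>
      ∑ k ∈ Finset.range (N + 1), (Real.exp (lam * k / (N + 1) - lam) - a) *
        (L (uniformGrid lam N ((N + 1) * j + (k + 1))) ω -
          L (uniformGrid lam N ((N + 1) * j + k)) ω) := by
    ext ω
    rw [hDsum N ω, innovationSum, Finset.mul_sum, ← Finset.sum_sub_distrib]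
    exact Finset.sum_congr rfl fun k _ => by ring
  have hVlim : TendstoInMeasure P (fun N ω => innovationSum L lam j N ω - a * D ω) atTop
      (fun ω => ξ ω - a * D ω) := by
    have h := hY.tendstoInMeasure_innovationSum j
    rw [tendstoInMeasure_iff_dist] at h ⊢
    simpa only [dist_sub_right] using h
  have hlim := variance_le_of_tendstoInMeasure (P := P)
    (B := b * |∫ ω, L lam ω ∂P|) (C := b ^ 2 * Var[L lam; P])
    (V := fun N ω => innovationSum L lam j N ω - a * D ω) (ξ := fun ω => ξ ω - a * D ω)
    (fun N => by
      rw [hVeq]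
      exact hL.memLp_weighted_sum (τ := fun k => uniformGrid lam N ((N + 1) * j + k)) (hτ N)
        (hstep N) (fun k : ℕ => Real.exp (lam * k / (N + 1) - lam) - a) (N + 1))
    hVlim (hξm.aestronglyMeasurable.sub (hD2.1.const_mul a))
    (fun N => by
      rw [hVeq, hL.integral_weighted_sum (τ := fun k => uniformGrid lam N ((N + 1) * j + k)) (hτ N)
        (hstep N) (fun k : ℕ => Real.exp (lam * k / (N + 1) - lam) - a) (N + 1), ← hmean N,
        abs_mul, abs_mul, ← mul_assoc]
      refine mul_le_mul_of_nonneg_right ?_ (abs_nonneg _)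
      refine (Finset.abs_sum_le_sum_abs _ _).trans
        ((Finset.sum_le_card_nsmul _ _ b (hw N)).trans ?_)
      rw [Finset.card_range, nsmul_eq_mul, mul_comm, abs_of_nonneg (by positivity)]
      push_cast
      rfl)
    (fun N => by
      rw [hVeq, hL.variance_weighted_sum (τ := fun k => uniformGrid lam N ((N + 1) * j + k)) (hτ N)
        (hstep N) (fun k : ℕ => Real.exp (lam * k / (N + 1) - lam) - a) (N + 1), ← hvar N,
        ← mul_assoc]
      refine mul_le_mul_of_nonneg_right ?_ (variance_nonneg _ _)
      refine (Finset.sum_le_card_nsmul _ _ (b ^ 2) fun k hk => ?_).trans ?_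
      · rw [← sq_abs]
        exact pow_le_pow_left₀ (abs_nonneg _) (hw N k hk) 2
      · rw [Finset.card_range, nsmul_eq_mul, mul_comm]
        push_cast
        rfl)
  have hξ2 : MemLp ξ 2 P := by
    refine (hlim.1.add (hD2.const_mul a)).ae_eq (ae_of_all _ fun ω => ?_)
    simp
  refine ⟨hξ2, (variance_nonneg _ _).lt_of_ne' fun h0 => ?_⟩
  have hconst := ae_eq_integral_of_variance_eq_zero hξ2 h0
  have hle := hlim.2
  have hcongr : (fun ω => ξ ω - a * D ω) =ᵐ[P] fun ω => (∫ ω', ξ ω' ∂P) - a * D ω := by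
    filter_upwards [hconst] with ω hω
    rw [hω]
  rw [variance_congr hcongr, variance_const_sub (hD2.1.const_mul a), variance_const_mul,
    hDid.variance_eq] at hle
  have hab : b ^ 2 < a ^ 2 := by simp only [a, b]; nlinarith
  exact absurd hle (not_le.2 (mul_lt_mul_of_pos_right hab hv))

end IsLevyProcess

/-- The sample autocorrelations of the discretely observed Ornstein–Uhlenbeck process are strongly
consistent. -/
theorem ae_tendsto_sampleAutocorr_observations [IsProbabilityMeasure P] {𝓕 : Filtration ℝ≥0 mΩ}
    (hL : IsLevyProcess P 𝓕 L) (h2 : MemLp (L 1) 2 P) (hσ : 0 < Var[L 1; P]) (hlam : 0 < lam)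
    (hYm : ∀ t, Measurable (Y t)) (hY : IsOUProcess P L lam Y) :
    ∀ᵐ ω ∂P, ∀ h : ℕ, Tendsto (fun n => sampleAutocorr (observations Y ω) n h) atTop
      (𝓝 (Real.exp (-(lam * h)))) := by
  let ξ : ℕ → Ω → ℝ := fun j ω => Y (j + 1 : ℕ) ω - Real.exp (-lam) * Y j ω
  have hξm (j : ℕ) : Measurable (ξ j) := by fun_prop
  obtain ⟨hξ2, hξv⟩ := hL.memLp_innovation_and_variance_pos hY hYm h2 hσ hlam 1
  -- versions of the innovations that are adapted to the filtration
  choose ζ hζm hζ using fun j => exists_measurable_version_of_tendstoInMeasure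
    (hL.measurable_innovationSum (lam := lam) j) (hY.tendstoInMeasure_innovationSum j)
  let 𝓖 : Filtration ℕ mΩ := ⟨fun i => 𝓕 (lam * (i + 1 : ℕ)), fun i k hik =>
    𝓕.mono (mul_le_mul_of_nonneg_left (Nat.cast_le.2 (Nat.succ_le_succ hik)) zero_le),
    fun i => 𝓕.le _⟩
  let μ : ℝ := ∫ ω, ξ 1 ω ∂P
  let η : ℕ → Ω → ℝ := fun i ω => ζ (i + 1) ω - μ
  have hζm' (j : ℕ) : Measurable (ζ j) := (hζm j).mono (𝓕.le _) le_rfl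
  have hζid (j : ℕ) : IdentDistrib (ζ j) (ξ j) P P :=
    (IdentDistrib.of_ae_eq (hξm j).aemeasurable (hζ j)).symm
  have hζ1 : MemLp (ζ 1) 2 P := (hζid 1).memLp_iff.2 hξ2
  have hη : IsInnovation P 𝓖 η := by
    refine ⟨fun i => (hζm (i + 1)).sub measurable_const, fun i => ?_, fun i => ?_,
      hζ1.sub (memLp_const μ), ?_⟩
    · have h3 : Indep (MeasurableSpace.comap (ζ (i + 1)) inferInstance)
          (𝓕 (lam * (i + 1 : ℕ))) P := by
        have hI := hL.indep_innovation hY hYm (i + 1)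
        rw [Indep_iff] at hI ⊢
        rintro _ A ⟨B, hB, rfl⟩ hA
        have e : ζ (i + 1) ⁻¹' B =ᵐ[P] ξ (i + 1) ⁻¹' B := by
          filter_upwards [hζ (i + 1)] with ω hω
          exact congrArg (· ∈ B) hω.symm
        rw [measure_congr (e.inter (ae_eq_refl A)), measure_congr e]
        exact hI _ A ⟨B, hB, rfl⟩ hA
      refine indep_of_indep_of_le_left h3 ?_
      rintro _ ⟨B, hB, rfl⟩
      exact ⟨(fun x => x - μ) ⁻¹' B, (measurable_id.sub_const μ) hB, rfl⟩
    · exact (((hζid (i + 1)).trans (hL.identDistrib_innovation hY hYm (i + 1) 1)).trans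
        (hζid 1).symm).comp (measurable_id.sub_const μ)
    · simp only [η]
      rw [integral_sub (hζ1.integrable one_le_two) (integrable_const _), (hζid 1).integral_eq]
      simp [μ]
  have hησ : 0 < ∫ ω, η 0 ω ^ 2 ∂P := by
    have e := variance_of_integral_eq_zero hη.memLp_zero.1.aemeasurable hη.integral_zero
    rw [← e]
    simp only [η, zero_add]
    rw [variance_sub_const hζ1.1, (hζid 1).variance_eq]
    exact hξv
  have hφ1 : Real.exp (-(lam : ℝ)) < 1 := Real.exp_lt_one_iff.2 (by simpa using hlam)
  have hφ1' : 1 - Real.exp (-(lam : ℝ)) ≠ 0 := by linarith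
  have key := hη.ae_tendsto_sampleAutocorr (Real.exp_pos (-(lam : ℝ))).le hφ1 hησ
    (y := fun i ω => Y i ω) (c := μ / (1 - Real.exp (-lam))) (by
      filter_upwards [ae_all_iff.2 hζ] with ω hω i
      simp only [η, ← hω (i + 1)]
      field_simp
      ring)
  filter_upwards [key] with ω hω h
  have := hω h
  rwa [← Real.exp_nat_mul, mul_neg, mul_comm] at this

end Innovations

/-! ### Second moments from the Lévy–Khintchine formula -/

section LevyKhintchine

variable {ν m : Measure ℝ}

lemma integrable_sq_of_expMomentCondition
    (hν : (∫⁻ x, ENNReal.ofReal (min 1 (x ^ 2)) ∂ν) < ∞) (hM : ExpMomentCondition ν) :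
    Integrable (fun x : ℝ => x ^ 2) ν := by
  obtain ⟨M, hM0, hM⟩ := hM
  refine ⟨by fun_prop, ?_⟩
  rw [hasFiniteIntegral_iff_ofReal (ae_of_all _ fun x => sq_nonneg x)]
  have hS : MeasurableSet {x : ℝ | 1 < |x|} := measurableSet_lt measurable_const (by fun_prop)
  rw [← lintegral_add_compl _ hS]
  refine ENNReal.add_lt_top.2 ⟨?_, ?_⟩
  · -- `M² x² / 2 ≤ e^{M |x|} ≤ e^{M x} + e^{-M x}`
    have hle (x : ℝ) : ENNReal.ofReal (x ^ 2) ≤ ENNReal.ofReal (2 / M ^ 2) *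
        (ENNReal.ofReal (Real.exp (M * x)) + ENNReal.ofReal (Real.exp (-M * x))) := by
      rw [← ENNReal.ofReal_add (Real.exp_pos _).le (Real.exp_pos _).le,
        ← ENNReal.ofReal_mul (by positivity)]
      refine ENNReal.ofReal_le_ofReal ?_
      have h1 := Real.quadratic_le_exp_of_nonneg (x := M * |x|) (by positivity)
      have h2 : Real.exp (M * |x|) ≤ Real.exp (M * x) + Real.exp (-M * x) := by
        rcases abs_cases x with ⟨h, -⟩ | ⟨h, -⟩
        · rw [h]; linarith [Real.exp_pos (-M * x)]
        · rw [h, mul_neg, ← neg_mul]; linarith [Real.exp_pos (M * x)]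
      have h3 : M ^ 2 * x ^ 2 / 2 ≤ Real.exp (M * x) + Real.exp (-M * x) := by
        rw [mul_pow, sq_abs] at h1
        have : 0 ≤ M * |x| := by positivity
        linarith
      calc x ^ 2 = 2 / M ^ 2 * (M ^ 2 * x ^ 2 / 2) := by field_simp
        _ ≤ _ := mul_le_mul_of_nonneg_left h3 (by positivity)
    refine (lintegral_mono hle).trans_lt ?_
    rw [lintegral_const_mul _ (by fun_prop), lintegral_add_left (by fun_prop)]
    exact ENNReal.mul_lt_top ENNReal.ofReal_lt_top (ENNReal.add_lt_top.2
      ⟨hM M (abs_of_pos hM0).le, hM (-M) (by rw [abs_neg, abs_of_pos hM0])⟩)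
  · refine lt_of_le_of_lt ?_ hν
    refine (setLIntegral_mono' hS.compl fun x hx => ?_).trans (setLIntegral_le_lintegral _ _)
    have hx1 : |x| ≤ 1 := not_lt.1 hx
    rw [min_eq_right]
    rw [← sq_abs]
    exact pow_le_one₀ (abs_nonneg x) hx1

/-- Lower bound for the modulus of an infinitely divisible characteristic function; the drift and
the compensator do not enter. -/
lemma exists_one_sub_sq_norm_charFun_le (hν : IsLevyMeasure ν m) (hM : ExpMomentCondition ν) :
    ∃ C : ℝ, ∀ u : ℝ, 1 - ‖charFun m u‖ ^ 2 ≤ C * u ^ 2 := by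
  obtain ⟨-, hν2, b, c, -, hchar⟩ := hν
  have hsq := integrable_sq_of_expMomentCondition hν2 hM
  refine ⟨c + ∫ x, x ^ 2 ∂ν, fun u => ?_⟩
  let g : ℝ → ℂ := fun x => Complex.exp (Complex.I * u * x) - 1 -
    Complex.I * u * (Set.indicator {y : ℝ | |y| ≤ 1} (fun y => y) x : ℝ)
  have hS : MeasurableSet {y : ℝ | |y| ≤ 1} := measurableSet_le (by fun_prop) measurable_const
  have hg : Integrable g ν := by
    have hm : Measurable (Set.indicator {y : ℝ | |y| ≤ 1} (fun y => y)) :=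
      measurable_id.indicator hS
    refine (hsq.const_mul (u ^ 2 * Real.exp |u| + 2)).mono'
      (Measurable.aestronglyMeasurable (by fun_prop)) (ae_of_all _ fun x => ?_)
    have hux : Complex.I * u * x = ((u * x : ℝ) : ℂ) * Complex.I := by push_cast; ring
    by_cases hx : |x| ≤ 1
    · have h1 := Complex.norm_exp_sub_sum_le_norm_mul_exp (Complex.I * u * x) 2
      simp only [Finset.sum_range_succ, Finset.sum_range_zero, zero_add, pow_zero,
        Nat.factorial_zero, Nat.cast_one, div_one, pow_one, Nat.factorial_one, ← sub_sub] at h1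
      have hn : ‖Complex.I * u * x‖ = |u| * |x| := by simp
      have h2 : g x = Complex.exp (Complex.I * u * x) - 1 - Complex.I * u * x := by
        simp only [g]
        rw [Set.indicator_of_mem (show x ∈ {y : ℝ | |y| ≤ 1} from hx)]
      rw [h2]
      refine h1.trans ?_
      rw [hn, mul_pow, sq_abs, sq_abs]
      have h3 : Real.exp (|u| * |x|) ≤ Real.exp |u| :=
        Real.exp_le_exp.2 (mul_le_of_le_one_right (abs_nonneg u) hx)
      have h4 := mul_le_mul_of_nonneg_left h3 (show 0 ≤ u ^ 2 * x ^ 2 by positivity)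
      nlinarith [sq_nonneg x]
    · have h2 : g x = Complex.exp (Complex.I * u * x) - 1 := by
        simp only [g]
        rw [Set.indicator_of_notMem (show x ∉ {y : ℝ | |y| ≤ 1} from hx)]
        simp
      rw [h2, hux]
      refine (norm_sub_le _ _).trans ?_
      rw [Complex.norm_exp_ofReal_mul_I, norm_one]
      have h5 : 1 ≤ x ^ 2 := by
        rw [← sq_abs]
        exact one_le_pow₀ (not_le.1 hx).le
      have : 0 ≤ u ^ 2 * Real.exp |u| * x ^ 2 := by positivity
      nlinarith
  have hre (x : ℝ) : (g x).re = Real.cos (u * x) - 1 := by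
    have hux : Complex.I * u * x = ((u * x : ℝ) : ℂ) * Complex.I := by push_cast; ring
    simp only [g, hux, Complex.sub_re, Complex.exp_ofReal_mul_I_re, Complex.one_re]
    simp
  have hint : -(u ^ 2 / 2 * ∫ x, x ^ 2 ∂ν) ≤ (∫ x, g x ∂ν).re := by
    have h1 : (∫ x, g x ∂ν).re = ∫ x, (g x).re ∂ν := (integral_re hg).symm
    rw [h1, ← integral_const_mul, ← integral_neg]
    refine integral_mono (hsq.const_mul _).neg hg.re fun x => ?_
    simp only [hre]
    have := Real.one_sub_sq_div_two_le_cos (x := u * x)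
    linarith [mul_pow u x 2]
  have hnorm : ‖charFun m u‖ ^ 2 = Real.exp (2 * (-(c * u ^ 2 / 2) + (∫ x, g x ∂ν).re)) := by
    rw [hchar u, Complex.norm_exp, ← Real.exp_nat_mul]
    congr 2
    have e1 : (Complex.I * b * u).re = 0 := by simp
    have e2 : ((c : ℂ) * u ^ 2 / 2).re = c * u ^ 2 / 2 := by
      rw [show (c : ℂ) * u ^ 2 / 2 = ((c * u ^ 2 / 2 : ℝ) : ℂ) by push_cast; ring]
      exact Complex.ofReal_re _
    rw [Complex.add_re, Complex.sub_re, e1, e2]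
    ring
  have hexp := Real.add_one_le_exp (2 * (-(c * u ^ 2 / 2) + (∫ x, g x ∂ν).re))
  rw [hnorm]
  linarith

/-- The characteristic function of the symmetrization of a law. -/
lemma integral_cos_sub_prod [IsProbabilityMeasure m] (u : ℝ) :
    ∫ p : ℝ × ℝ, Real.cos (u * (p.1 - p.2)) ∂(m.prod m) = ‖charFun m u‖ ^ 2 := by
  have hcos : Integrable (fun x => Real.cos (u * x)) m :=
    (integrable_const (1 : ℝ)).mono' (by fun_prop)
      (ae_of_all _ fun x => by simpa using Real.abs_cos_le_one _)
  have hsin : Integrable (fun x => Real.sin (u * x)) m :=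
    (integrable_const (1 : ℝ)).mono' (by fun_prop)
      (ae_of_all _ fun x => by simpa using Real.abs_sin_le_one _)
  have hexp : Integrable (fun x : ℝ => Complex.exp (u * x * Complex.I)) m :=
    (integrable_const (1 : ℝ)).mono' (Measurable.aestronglyMeasurable (by fun_prop))
      (ae_of_all _ fun x => by
        rw [← Complex.ofReal_mul, Complex.norm_exp_ofReal_mul_I])
  have hre : (charFun m u).re = ∫ x, Real.cos (u * x) ∂m := by
    rw [charFun_apply_real]
    refine (integral_re hexp).symm.trans (integral_congr_ae (ae_of_all _ fun x => ?_))
    simp only [← Complex.ofReal_mul]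
    exact Complex.exp_ofReal_mul_I_re _
  have him : (charFun m u).im = ∫ x, Real.sin (u * x) ∂m := by
    rw [charFun_apply_real]
    refine (integral_im hexp).symm.trans (integral_congr_ae (ae_of_all _ fun x => ?_))
    simp only [← Complex.ofReal_mul]
    exact Complex.exp_ofReal_mul_I_im _
  rw [Complex.sq_norm, Complex.normSq_apply, hre, him, ← integral_prod_mul, ← integral_prod_mul,
    ← integral_add (hcos.mul_prod hcos) (hsin.mul_prod hsin)]
  refine integral_congr_ae (ae_of_all _ fun p => ?_)
  simp only [mul_sub, Real.cos_sub]

/-- A law whose characteristic function satisfies `1 - |φ(u)|² ≤ C u²` has a finite second moment: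
by Fatou's lemma its symmetrization does. -/
lemma memLp_two_of_charFun_bound [IsProbabilityMeasure m] {C : ℝ}
    (hC : ∀ u : ℝ, 1 - ‖charFun m u‖ ^ 2 ≤ C * u ^ 2) : MemLp (fun x : ℝ => x) 2 m := by
  let f : ℕ → ℝ × ℝ → ℝ := fun n p =>
    Real.pi ^ 2 / 2 * ((n : ℝ) + 1) ^ 2 * (1 - Real.cos (1 / ((n : ℝ) + 1) * (p.1 - p.2)))
  have hf0 (n : ℕ) (p : ℝ × ℝ) : 0 ≤ f n p :=
    mul_nonneg (by positivity) (sub_nonneg.2 (Real.cos_le_one _))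
  have hcosi (u : ℝ) : Integrable (fun p : ℝ × ℝ => Real.cos (u * (p.1 - p.2))) (m.prod m) :=
    (integrable_const (1 : ℝ)).mono' (by fun_prop)
      (ae_of_all _ fun x => by simpa using Real.abs_cos_le_one _)
  have hfi (n : ℕ) : Integrable (f n) (m.prod m) :=
    ((integrable_const 1).sub (hcosi _)).const_mul _
  have hfC (n : ℕ) : ∫⁻ p, ENNReal.ofReal (f n p) ∂(m.prod m) ≤
      ENNReal.ofReal (Real.pi ^ 2 / 2 * C) := by
    rw [← ofReal_integral_eq_lintegral_ofReal (hfi n) (ae_of_all _ (hf0 n))]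
    refine ENNReal.ofReal_le_ofReal ?_
    simp only [f]
    rw [integral_const_mul, integral_sub (integrable_const _) (hcosi _), integral_cos_sub_prod]
    have h := hC (1 / ((n : ℝ) + 1))
    have hn : (0 : ℝ) < (n : ℝ) + 1 := by positivity
    calc _ ≤ Real.pi ^ 2 / 2 * ((n : ℝ) + 1) ^ 2 * (C * (1 / ((n : ℝ) + 1)) ^ 2) := by
          refine mul_le_mul_of_nonneg_left ?_ (by positivity)
          simpa using h
      _ = Real.pi ^ 2 / 2 * C := by field_simp
  have hlim (p : ℝ × ℝ) : ENNReal.ofReal ((p.1 - p.2) ^ 2) ≤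
      liminf (fun n => ENNReal.ofReal (f n p)) atTop := by
    refine le_liminf_of_le (by isBoundedDefault) ?_
    obtain ⟨N, hN⟩ := exists_nat_ge (|p.1 - p.2| / Real.pi)
    filter_upwards [eventually_ge_atTop N] with n hn
    refine ENNReal.ofReal_le_ofReal ?_
    have hn0 : (0 : ℝ) < (n : ℝ) + 1 := by positivity
    have hn' : (N : ℝ) ≤ n := Nat.cast_le.2 hn
    have hle : |1 / ((n : ℝ) + 1) * (p.1 - p.2)| ≤ Real.pi := by
      rw [abs_mul, abs_of_pos (by positivity), one_div_mul_eq_div, div_le_iff₀ hn0]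
      rw [div_le_iff₀ Real.pi_pos] at hN
      nlinarith [Real.pi_pos]
    have h := Real.cos_le_one_sub_mul_cos_sq hle
    calc (p.1 - p.2) ^ 2 = Real.pi ^ 2 / 2 * ((n : ℝ) + 1) ^ 2 *
          (2 / Real.pi ^ 2 * (1 / ((n : ℝ) + 1) * (p.1 - p.2)) ^ 2) := by
            have := Real.pi_ne_zero
            field_simp
      _ ≤ f n p := mul_le_mul_of_nonneg_left (by linarith) (by positivity)
  have hsq : Integrable (fun p : ℝ × ℝ => (p.1 - p.2) ^ 2) (m.prod m) := by
    refine ⟨by fun_prop, ?_⟩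
    rw [hasFiniteIntegral_iff_ofReal (ae_of_all _ fun p => sq_nonneg _)]
    refine ((lintegral_mono hlim).trans ((lintegral_liminf_le' fun n =>
      (hfi n).1.aemeasurable.ennreal_ofReal).trans
        (liminf_le_of_frequently_le' (Frequently.of_forall hfC)))).trans_lt ENNReal.ofReal_lt_top
  obtain ⟨y, hy⟩ := hsq.prod_left_ae.exists
  have h2 : MemLp (fun x : ℝ => x - y) 2 m := (memLp_two_iff_integrable_sq (by fun_prop)).2 hy
  refine (h2.add (memLp_const y)).ae_eq (ae_of_all _ fun x => ?_)
  simp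

lemma memLp_two_of_isLevyMeasure [IsProbabilityMeasure m] (hν : IsLevyMeasure ν m)
    (hM : ExpMomentCondition ν) : MemLp (fun x : ℝ => x) 2 m := by
  obtain ⟨C, hC⟩ := exists_one_sub_sq_norm_charFun_le hν hM
  exact memLp_two_of_charFun_bound hC

end LevyKhintchine

end LevyOU

theorem lemma3p3 {Ω : Type*} {mΩ : MeasurableSpace Ω} (P : Measure Ω) [IsProbabilityMeasure P]
    (𝓕 : Filtration ℝ≥0 mΩ) (L : ℝ≥0 → Ω → ℝ) (hL : LevyOU.IsLevyProcess P 𝓕 L)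
    -- the Lévy measure of `L_1` and its exponential moment condition; `Var L_1 > 0`
    (ν : Measure ℝ) (hν : LevyOU.IsLevyMeasure ν (P.map (L 1)))
    (hM : LevyOU.ExpMomentCondition ν) (hσ : 0 < Var[L 1; P])
    -- the stationary Ornstein–Uhlenbeck process with true parameter `lam₀`
    (lam₀ : ℝ≥0) (hlam₀ : 0 < lam₀) (Y : ℝ≥0 → Ω → ℝ) (hYm : ∀ t, Measurable (Y t))
    (hY : LevyOU.IsOUProcess P L lam₀ Y)
    (hY0_indep : IndepFun (Y 0) (fun ω t => L t ω) P)
    (hY0_law : ∃ Z : Ω → ℝ,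
      LevyOU.IsImproperStochIntegral P (fun s => Real.exp (-(s : ℝ))) L 0 Z ∧
        IdentDistrib (Y 0) Z P P)
    (d : ℕ) (hd : 1 ≤ d)
    (K : Set ℝ) (hK : IsCompact K) (hK_nonneg : K ⊆ Set.Ici 0) (hlam₀K : (lam₀ : ℝ) ∈ K) :
    -- existence of the estimator
    (∀ (n : ℕ) (ω : Ω), (LevyOU.lsArgmin K (LevyOU.observations Y ω) d n).Nonempty) ∧
    -- local uniqueness: every minimizer has a neighbourhood containing no other minimizer
    (∀ (n : ℕ) (ω : Ω), ∀ x ∈ LevyOU.lsArgmin K (LevyOU.observations Y ω) d n,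
      ∃ U ∈ 𝓝 x, LevyOU.lsArgmin K (LevyOU.observations Y ω) d n ∩ U = {x}) ∧
    -- if `K` is an interval near `lam₀`, almost surely the minimizer is unique for all large `n`
    ((∃ ε : ℝ, 0 < ε ∧ (K ∩ Set.Icc ((lam₀ : ℝ) - ε) ((lam₀ : ℝ) + ε)).OrdConnected) →
      ∀ᵐ ω ∂P, ∀ᶠ n : ℕ in atTop,
        ∃! x : ℝ, x ∈ LevyOU.lsArgmin K (LevyOU.observations Y ω) d n) ∧
    -- strong consistency, for every choice of the minimizers
    (∀ᵐ ω ∂P, ∀ x : ℕ → ℝ,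
      (∀ n, x n ∈ LevyOU.lsArgmin K (LevyOU.observations Y ω) d n) →
        Tendsto x atTop (𝓝 (lam₀ : ℝ))) := by
  have hmap : IsProbabilityMeasure (P.map (L 1)) :=
    Measure.isProbabilityMeasure_map (hL.measurable 1).aemeasurable
  have h2 : MemLp (L 1) 2 P :=
    (memLp_map_measure_iff (g := fun x : ℝ => x) (by fun_prop) (hL.measurable 1).aemeasurable).1
      (LevyOU.memLp_two_of_isLevyMeasure hν hM)
  have hρ := LevyOU.ae_tendsto_sampleAutocorr_observations hL h2 hσ hlam₀ hYm hY
  refine ⟨fun n ω => LevyOU.lsArgmin_nonempty hK ⟨_, hlam₀K⟩ _ d n, fun n ω x hx =>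
    LevyOU.exists_nhds_inter_eq_singleton (LevyOU.finite_lsArgmin K _ hd n) hx, ?_, ?_⟩
  · rintro ⟨ε, hε, hord⟩
    filter_upwards [hρ] with ω hω
    exact LevyOU.eventually_existsUnique_lsArgmin hK hK_nonneg hlam₀K hd hω hε hord
  · filter_upwards [hρ] with ω hω x hx
    exact LevyOU.tendsto_of_mem_lsArgmin hlam₀K hd hω hx
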